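/- Notation. Points of $\mathbb R^{2n+k}$ are written $z=(q,p,\lambda)$ with $q,p\in\mathbb R^n$, $\lambda\in\mathbb R^k$, and $$J=\begin{pmatrix}0&-I_n&0\\ I_n&0&0\\0&0&0_{k\times k}\end{pmatrix}.$$ For a smooth $H$ on $\mathbb R^{2n+k}$ consider the generalized Hamiltonian system $J\dot z=\nabla H(z)$ with constraint set $C=\{z: H_\lambda(z)=0\}$. The system has \emph{index 1} if for all $(q,p)$ the equation $H_\lambda(q,p,\lambda)=0$ has a unique solution $\lambda=\tilde\lambda(q,p)$ and $\tilde\lambda$ is smooth; then $C$ is the graph of $\tilde\lambda$. A Runge--Kutta method $(a_{ij},b_i)_{i,j\le s}$ is \emph{symplectic} if $b_ib_j-b_ja_{ji}-b_ia_{ij}=0$ for all $i,j$. Applied with step $\Delta t$ to $J\dot z=\nabla H(z)$ it relates $z_0$ and $z_1$ through stages $Z_i$ and slopes $F_i$ with $$JZ_i=Jz_0+\Delta t\sum_j a_{ij}JF_j,\qquad Jz_1=Jz_0+\Delta t\sum_j b_jJF_j,\qquad JF_j=\nabla H(Z_j).$$ The method has order $r$ if, for every smooth ODE $\dot y=f(y)$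 on some $\mathbb R^d$, its one-step error is $O(\Delta t^{r+1})$. Consider the following two Hamiltonian formulations. (A) $M$ is a symmetric nonsingular $n\times n$ matrix, $V:\mathbb R^n\to\mathbb R$ and $g_1,\dots,g_k:\mathbb R^n\to\mathbb R^n$ are smooth, and $g_1(q),\dots,g_k(q)$ are linearly independent for each $q$. Moreover, $M$ is positive definite or, more generally, the $k\times k$ matrix with entries $g_i(q)\cdot M^{-1}g_j(q)$ is nonsingular for every $q$. The Hamiltonian is $$H(q,p,\lambda)=\tfrac12\Big(p+\sum_i\lambda_ig_i(q)\Big)^{T}M^{-1}\Big(p+\sum_i\lambda_ig_i(q)\Big)+V(q),$$ for the Lagrangian $\tfrac12\dot q^TM\dot q-V(q)$ with constraints $g_i(q)\cdot\dot q=0$. The velocity recovered by the Legendre transform is $\dot q=M^{-1}(p+\sum_i\lambda_ig_i(q))$. (B) $L,g_1,\dots,g_k:\mathbb R^n\times\mathbb R^n\to\mathbb R$ are smooth functions of $(q,\dot q)$, $F(q,\dot q,\lambda)=L(q,\dot q)-\sum_i\lambda_ig_i(q,\dot q)$, and the Legendre transform $(\dot q,q,\lambda)\mapsto(p,q,\lambda)$,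 $p=\nabla_{\dot q}F(q,\dot q,\lambda)$, is invertible with smooth inverse, giving $\dot q=w(q,p,\lambda)$. The Hamiltonian is $$H(q,p,\lambda)=\dot q\cdot p-F(q,\dot q,\lambda),\qquad \dot q=w(q,p,\lambda),$$ for the Lagrangian $L$ with constraints $g_i(q,\dot q)=0$. Moreover, either (i) the matrix $(\partial g_i/\partial\dot q_j)$ has rank $k$ and the Hessian $\partial^2L/\partial\dot q^2$ is positive definite at all $(q,\dot q)$, as is the case for sub-Riemannian problems, where $L=\langle\dot q,\dot q\rangle_q$; or (ii) the system $J\dot z=\nabla H(z)$ has index 1. Then, in both cases, the system $J\dot z=\nabla H(z)$ has index 1, and for every symplectic Runge--Kutta method, with endpoint multipliers defined by $H_\lambda=0$: (1) (Well-defined, constraint-preserving, symplectic.) For every compact $K\subset\mathbb R^{2n+k}$ and every $\delta>0$ there are $h_0>0$ and an open $U\supseteq K$ such that for $|\Delta t|<h_0$ and every $z_0\in U$ the Runge--Kutta equations have exactly one solution $(Z_1,\dots,Z_s,z_1)$ with $|JZ_i-Jz_0|\le\delta$ for all $i$ and $z_1\in C$. The $Z_i$ and $z_1=\Phi(z_0)$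 are smooth functions of $z_0\in U$, $\Phi$ maps $U$ into $C$, and $\Phi^*\omega=\omega$ on $U$ for $\omega=\tfrac12dz\wedge J\,dz$; in particular $\Phi$ preserves the restriction of $\omega$ to $C$. (2) (Convergent, with the order of the method.) If the method has order $r\ge1$ and $z(t)$ is a solution of $J\dot z=\nabla H(z)$ on $[t_0,t_1]$, then for every $\delta>0$ there are $B$ and $h_0>0$ such that for $0<\Delta t\le h_0$ the numerical solution $z_m$ with $z_0=z(t_0)$ exists as long as $m\Delta t\le t_1-t_0$, and satisfies $|z_m-z(t_0+m\Delta t)|\le B\,\Delta t^{\,r}$. (3) (Exact constraints.) For any solution of the Runge--Kutta equations over any number of steps of any size, the constraints $g_i(q)\cdot\dot q=0$ (in case (A)), respectively $g_i(q,\dot q)=0$ (in case (B)), with $\dot q$ recovered by the Legendre transform, hold exactly at all stages; and if the endpoint multipliers $\lambda_m$ are defined by $H_\lambda(q_m,p_m,\lambda_m)=0$, they hold exactly at all endpoints. -/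

import Mathlib

open scoped Matrix ContDiff

/-- The vector of partial derivatives of a real function of finitely many real variables. -/
noncomputable def grad {ι : Type*} [Fintype ι] [DecidableEq ι] (f : (ι → ℝ) → ℝ) (x : ι → ℝ) :
    ι → ℝ :=
  fun i => fderiv ℝ f x (Pi.single i 1)

/-! ### The extended phase space of points `z = (q, p, l)` in `ℝ ^ (2 n + k)` -/

/-- Points `z = (q, p, l)` with `q, p` in `ℝ ^ n` and multipliers `l` in `ℝ ^ k`. -/
abbrev Phase (n k : ℕ) : Type := Fin n ⊕ (Fin n ⊕ Fin k) → ℝ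

/-- The position component `q` of `z = (q, p, l)`. -/
def posn {n k : ℕ} (z : Phase n k) : Fin n → ℝ := fun i => z (Sum.inl i)

/-- The momentum component `p` of `z = (q, p, l)`. -/
def momn {n k : ℕ} (z : Phase n k) : Fin n → ℝ := fun i => z (Sum.inr (Sum.inl i))

/-- The multiplier component `l` of `z = (q, p, l)`. -/
def mult {n k : ℕ} (z : Phase n k) : Fin k → ℝ := fun i => z (Sum.inr (Sum.inr i))

/-- The structure matrix with block rows `(0, -I, 0)`, `(I, 0, 0)`, `(0, 0, 0)`. -/
def structJ (n k : ℕ) :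
    Matrix (Fin n ⊕ (Fin n ⊕ Fin k)) (Fin n ⊕ (Fin n ⊕ Fin k)) ℝ :=
  Matrix.fromBlocks 0 (Matrix.fromCols (-1) 0) (Matrix.fromRows 1 0) 0

/-- The 2-form `½ dz ∧ J dz`, evaluated on two vectors; as `J` is antisymmetric, its value is
`u · J v`. It involves only the `q` and `p` components, and up to sign it is `dq ∧ dp`. -/
def preForm {n k : ℕ} (u v : Phase n k) : ℝ := u ⬝ᵥ (structJ n k *ᵥ v)

/-- The constraint set `C` of the system `J z' = ∇H(z)`: the points at which `∂H/∂l = 0`. -/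
def constraintSet {n k : ℕ} (H : Phase n k → ℝ) : Set (Phase n k) :=
  {z | mult (grad H z) = 0}

/-- Index one: for all `(q, p)` the equation `∂H/∂l (q, p, l) = 0` has exactly one solution `l`,
and this solution is a smooth function of `(q, p)`; the constraint set is its graph. -/
def IndexOne {n k : ℕ} (H : Phase n k → ℝ) : Prop :=
  ∃ lam : (Fin n → ℝ) × (Fin n → ℝ) → (Fin k → ℝ), ContDiff ℝ ∞ lam ∧
    ∀ z : Phase n k, z ∈ constraintSet H ↔ mult z = lam (posn z, momn z)

/-- `z` solves the generalized Hamiltonian system `J z' = ∇H(z)` on `[t₀, t₁]`. -/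
def IsGenHamSolution {n k : ℕ} (H : Phase n k → ℝ) (t₀ t₁ : ℝ) (z : ℝ → Phase n k) : Prop :=
  ∀ t ∈ Set.Icc t₀ t₁, ∃ z' : Phase n k,
    HasDerivWithinAt z z' (Set.Icc t₀ t₁) t ∧ structJ n k *ᵥ z' = grad H (z t)

/-! ### Runge-Kutta methods -/

/-- The coefficients of a symplectic Runge-Kutta method. -/
def IsSymplecticRK {s : ℕ} (a : Matrix (Fin s) (Fin s) ℝ) (b : Fin s → ℝ) : Prop :=
  ∀ i j, b i * b j - b j * a j i - b i * a i j = 0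

/-- The Runge-Kutta method has order (at least) `r`: for every smooth autonomous ordinary
differential equation `y' = f y` and every solution `y`, the error after one step of length `h`
from `y 0` is `O(h ^ (r + 1))`. The stages are those near `y 0`; for small `h` they exist and are
unique. -/
def RKHasOrder {s : ℕ} (a : Matrix (Fin s) (Fin s) ℝ) (b : Fin s → ℝ) (r : ℕ) : Prop :=
  ∀ (d : ℕ) (f : (Fin d → ℝ) → (Fin d → ℝ)), ContDiff ℝ ∞ f →
    ∀ (y : ℝ → (Fin d → ℝ)) (ε : ℝ), 0 < ε →
      (∀ t ∈ Set.Ioo (-ε) ε, HasDerivAt y (f (y t)) t) →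
      ∃ B : ℝ, ∃ δ > 0, ∃ h₀ > 0, ∀ h : ℝ, 0 < h → h ≤ h₀ →
        ∀ Y : Fin s → (Fin d → ℝ),
          (∀ i, Y i = y 0 + h • ∑ j, a i j • f (Y j)) →
          (∀ i, ‖Y i - y 0‖ ≤ δ) →
          ‖y 0 + h • ∑ j, b j • f (Y j) - y h‖ ≤ B * h ^ (r + 1)

/-- The Runge-Kutta equations for `J z' = ∇H(z)` with step `h` from `z₀` to `z₁`, with stages
`Z i` and stage slopes `F i`. They do not involve the multiplier components of `z₀` and `z₁`. -/
def RKStep {n k s : ℕ} (a : Matrix (Fin s) (Fin s) ℝ) (b : Fin s → ℝ) (H : Phase n k → ℝ)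
    (h : ℝ) (z₀ : Phase n k) (Z : Fin s → Phase n k) (z₁ : Phase n k) : Prop :=
  ∃ F : Fin s → Phase n k,
    (∀ i, structJ n k *ᵥ Z i
      = structJ n k *ᵥ z₀ + h • ∑ j, a i j • (structJ n k *ᵥ F j)) ∧
    (structJ n k *ᵥ z₁ = structJ n k *ᵥ z₀ + h • ∑ j, b j • (structJ n k *ᵥ F j)) ∧
    (∀ j, structJ n k *ᵥ F j = grad H (Z j))

/-- One step of the integrator: the Runge-Kutta equations hold, the `(q, p)` components of the
stages are within `δ` of those of `z₀` (this selects the relevant solution of the implicit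
equations), and the multipliers at the new endpoint are defined by `∂H/∂l = 0`. -/
def IntegratorStep {n k s : ℕ} (a : Matrix (Fin s) (Fin s) ℝ) (b : Fin s → ℝ)
    (H : Phase n k → ℝ) (δ h : ℝ) (z₀ : Phase n k) (Z : Fin s → Phase n k) (z₁ : Phase n k) :
    Prop :=
  RKStep a b H h z₀ Z z₁ ∧ (∀ i, ‖structJ n k *ᵥ Z i - structJ n k *ᵥ z₀‖ ≤ δ) ∧
    z₁ ∈ constraintSet H

/-- For all sufficiently small steps `h`, uniformly on compact sets, the method is a well-defined
smooth map `Φ : z₀ ↦ z₁` into the constraint set (in particular from the constraint set to itself),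
its stages are smooth functions of `z₀`, and `Φ` preserves the 2-form `½ dz ∧ J dz` (on all
vectors, in particular on those tangent to the constraint set). -/
def IsWellDefinedSymplectic {n k s : ℕ} (a : Matrix (Fin s) (Fin s) ℝ) (b : Fin s → ℝ)
    (H : Phase n k → ℝ) : Prop :=
  ∀ K : Set (Phase n k), IsCompact K → ∀ δ > 0,
    ∃ h₀ > 0, ∃ U : Set (Phase n k), IsOpen U ∧ K ⊆ U ∧ ∀ h : ℝ, |h| < h₀ →
      ∃ (Φ : Phase n k → Phase n k) (S : Fin s → Phase n k → Phase n k),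
        ContDiffOn ℝ ∞ Φ U ∧ (∀ i, ContDiffOn ℝ ∞ (S i) U) ∧
        (∀ z₀ ∈ U, ∀ (Z : Fin s → Phase n k) (z₁ : Phase n k),
          IntegratorStep a b H δ h z₀ Z z₁ ↔ (∀ i, Z i = S i z₀) ∧ z₁ = Φ z₀) ∧
        (∀ z₀ ∈ U, Φ z₀ ∈ constraintSet H) ∧
        (∀ z₀ ∈ U, ∀ u v : Phase n k,
          preForm (fderiv ℝ Φ z₀ u) (fderiv ℝ Φ z₀ v) = preForm u v)

/-- `ζ 0, …, ζ N` is produced by `N` steps of the integrator from the initial value `z₀`. -/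
def IsNumericalSolution {n k s : ℕ} (a : Matrix (Fin s) (Fin s) ℝ) (b : Fin s → ℝ)
    (H : Phase n k → ℝ) (δ h : ℝ) (N : ℕ) (z₀ : Phase n k) (ζ : ℕ → Phase n k) : Prop :=
  ζ 0 = z₀ ∧ ∀ m < N, ∃ Z : Fin s → Phase n k, IntegratorStep a b H δ h (ζ m) Z (ζ (m + 1))

/-- Convergence of order `r`: along every solution on `[t₀, t₁]`, for all small steps the numerical
solution exists up to time `t₁`, and its global error (multipliers included) is `O(h ^ r)`. -/
def IsConvergentOfOrder {n k s : ℕ} (a : Matrix (Fin s) (Fin s) ℝ) (b : Fin s → ℝ)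
    (H : Phase n k → ℝ) (r : ℕ) : Prop :=
  ∀ (t₀ t₁ : ℝ), t₀ < t₁ → ∀ z : ℝ → Phase n k, IsGenHamSolution H t₀ t₁ z →
    ∀ δ > 0, ∃ B : ℝ, ∃ h₀ > 0, ∀ h : ℝ, 0 < h → h ≤ h₀ → ∀ N : ℕ, N * h ≤ t₁ - t₀ →
      (∃ ζ, IsNumericalSolution a b H δ h N (z t₀) ζ) ∧
      ∀ ζ, IsNumericalSolution a b H δ h N (z t₀) ζ →
        ∀ m ≤ N, ‖ζ m - z (t₀ + m * h)‖ ≤ B * h ^ r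

/-- Let `vel z` be the velocity recovered at `z`. Along any solution of the Runge-Kutta equations
the constraints `c i (q, q') = 0` hold at all stages, and if the endpoint multipliers are defined
by `∂H/∂l = 0`, they also hold at all endpoints. -/
def ConstraintsExact {n k s : ℕ} (a : Matrix (Fin s) (Fin s) ℝ) (b : Fin s → ℝ)
    (H : Phase n k → ℝ) (c : Fin k → (Fin n → ℝ) → (Fin n → ℝ) → ℝ)
    (vel : Phase n k → (Fin n → ℝ)) : Prop :=
  ∀ (h : ℝ) (N : ℕ) (ζ : ℕ → Phase n k) (Z : ℕ → Fin s → Phase n k),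
    (∀ m < N, RKStep a b H h (ζ m) (Z m) (ζ (m + 1))) →
      (∀ m < N, ∀ j i, c i (posn (Z m j)) (vel (Z m j)) = 0) ∧
      ((∀ m ≤ N, ζ m ∈ constraintSet H) →
        ∀ m ≤ N, ∀ i, c i (posn (ζ m)) (vel (ζ m)) = 0)

/-! ### Mechanical Lagrangian with constraints linear in the velocity -/

/-- `p + ∑ i, l i • g i (q)`. -/
def shiftedMomentum {n k : ℕ} (g : Fin k → (Fin n → ℝ) → (Fin n → ℝ)) (z : Phase n k) :
    Fin n → ℝ :=
  momn z + ∑ i, mult z i • g i (posn z)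

/-- The velocity `M⁻¹ (p + ∑ i, l i • g i (q))`, the inverse of the Legendre transform
`p = M q' - ∑ i, l i • g i (q)`. -/
noncomputable def mechVelocity {n k : ℕ} (M : Matrix (Fin n) (Fin n) ℝ)
    (g : Fin k → (Fin n → ℝ) → (Fin n → ℝ)) (z : Phase n k) : Fin n → ℝ :=
  M⁻¹ *ᵥ shiftedMomentum g z

/-- `H(q,p,l) = ½ (p + ∑ l i • g i (q)) · M⁻¹ (p + ∑ l i • g i (q)) + V(q)`. -/
noncomputable def mechHamiltonian {n k : ℕ} (M : Matrix (Fin n) (Fin n) ℝ)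
    (V : (Fin n → ℝ) → ℝ) (g : Fin k → (Fin n → ℝ) → (Fin n → ℝ)) (z : Phase n k) : ℝ :=
  (1 / 2) * (shiftedMomentum g z ⬝ᵥ (M⁻¹ *ᵥ shiftedMomentum g z)) + V (posn z)

/-! ### General Lagrangian and general velocity-dependent constraints -/

/-- The extended Lagrangian `F(q, v, l) = L(q, v) - ∑ i, l i * g i (q, v)`. -/
def extLagrangian {n k : ℕ} (L : (Fin n → ℝ) → (Fin n → ℝ) → ℝ)
    (g : Fin k → (Fin n → ℝ) → (Fin n → ℝ) → ℝ) (q v : Fin n → ℝ) (l : Fin k → ℝ) : ℝ :=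
  L q v - ∑ i, l i * g i q v

/-- The Legendre transform `p = ∇_v F(q, v, l)`. -/
noncomputable def legendre {n k : ℕ} (L : (Fin n → ℝ) → (Fin n → ℝ) → ℝ)
    (g : Fin k → (Fin n → ℝ) → (Fin n → ℝ) → ℝ) (q v : Fin n → ℝ) (l : Fin k → ℝ) :
    Fin n → ℝ :=
  grad (fun v' => extLagrangian L g q v' l) v

/-- The map `z = (q, p, l) ↦ w z` is the velocity component of a smooth inverse of the Legendre
transform mapping `(v, q, l) ↦ (p, q, l)`. -/
structure IsLegendreInverse {n k : ℕ} (L : (Fin n → ℝ) → (Fin n → ℝ) → ℝ)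
    (g : Fin k → (Fin n → ℝ) → (Fin n → ℝ) → ℝ) (w : Phase n k → (Fin n → ℝ)) : Prop where
  smooth : ContDiff ℝ ∞ w
  right_inv : ∀ z, legendre L g (posn z) (w z) (mult z) = momn z
  left_inv : ∀ z v, legendre L g (posn z) v (mult z) = momn z → w z = v

/-- `H(z) = v · p - F(q, v, l)` with `v = w z`. -/
noncomputable def genHamiltonian {n k : ℕ} (L : (Fin n → ℝ) → (Fin n → ℝ) → ℝ)
    (g : Fin k → (Fin n → ℝ) → (Fin n → ℝ) → ℝ) (w : Phase n k → (Fin n → ℝ))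
    (z : Phase n k) : ℝ :=
  w z ⬝ᵥ momn z - extLagrangian L g (posn z) (w z) (mult z)

/-- The matrix `G(q, v)` with entries `∂ g i (q, v) / ∂ v j`. -/
noncomputable def velJacobian {n k : ℕ} (g : Fin k → (Fin n → ℝ) → (Fin n → ℝ) → ℝ)
    (q v : Fin n → ℝ) : Matrix (Fin k) (Fin n) ℝ :=
  Matrix.of fun i j => grad (g i q) v j

/-- The matrix of second derivatives of `L` with respect to the velocity. -/
noncomputable def velHessian {n : ℕ} (L : (Fin n → ℝ) → (Fin n → ℝ) → ℝ)
    (q v : Fin n → ℝ) : Matrix (Fin n) (Fin n) ℝ :=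
  Matrix.of fun i j => grad (fun v' => grad (L q) v' j) v i

/-! Everything rests on eliminating the multipliers. The last block row of `J` vanishes, so `J F =
∇H(Z)` contains the equation `∂H/∂l (Z) = 0`: every stage lies on the graph of the function `lam`
supplied by index one. As `J` sees only `x = (q, p)`, the Runge-Kutta equations of the constrained
system are those of the same method for the ordinary differential equation `x' = reducedField H lam
x` (`rkStep_iff`). This equation is the canonical Hamiltonian system of `x ↦ H (x, lam x)`, because
the chain-rule term through `lam` carries the factor `∂H/∂l = 0`; and `½ dz ∧ J dz` is the pullback
of the canonical form on `(q, p)`.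

The classical theory then applies. Small steps are solvable by contraction and smooth by the
implicit function theorem (`exists_rkSolution`). The differentiated step is a step for the
variational equation, whose bilinear invariants a symplectic method preserves
(`IsSymplecticRK.bilinear_invariant`). Order controls the error after one step for one solution at a
time; smoothness of that error in `(t, h)` makes the bound uniform, and stability sums it up
(`RKHasOrder.convergence`). Multipliers inherit the rate since `lam` is locally Lipschitz. The
constraints are exact because `∂H/∂l` is the constraint at the recovered velocity in both
formulations.

It remains to prove index one. In the mechanical case `∂H/∂l` is affine in `l` with matrix `G M⁻¹
Gᵀ`. In the general case with `L` convex, invertibility of the Legendre transform for every `l`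
makes `hess L - t hess g i` injective for all real `t`, which forces `hess g i = 0`: the constraints
are affine in the velocity. As a function of `l`, `H` is then the dual function `sup_v (v · p - L +
l · (c + Γ v))`. It is coercive because `Γ` is surjective, so it has a minimum, where `∂H/∂l = 0`;
positive definiteness of `hess L` gives uniqueness and nondegeneracy. -/

section

open Set Filter Topology Metric

/-- The implicit function theorem in finite dimension, with injectivity of the partial derivative
as the nondegeneracy condition. -/
theorem exists_contDiffAt_implicit {E W : Type*} [NormedAddCommGroup E] [NormedSpace ℝ E]
    [CompleteSpace E] [NormedAddCommGroup W] [NormedSpace ℝ W] [FiniteDimensional ℝ W]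
    {P : E × W → W} {x₀ : E} {w₀ : W} (hP : ContDiffAt ℝ ∞ P (x₀, w₀))
    (hinj : ∀ v, fderiv ℝ (fun w => P (x₀, w)) w₀ v = 0 → v = 0) :
    ∃ φ : E → W, ContDiffAt ℝ ∞ φ x₀ ∧ φ x₀ = w₀ ∧ ∀ᶠ x in 𝓝 x₀, P (x, φ x) = P (x₀, w₀) := by
  have : CompleteSpace W := FiniteDimensional.complete ℝ W
  have hd : DifferentiableAt ℝ P (x₀, w₀) := hP.differentiableAt (by simp)
  have hfd : fderiv ℝ (fun w => P (x₀, w)) w₀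
      = fderiv ℝ P (x₀, w₀) ∘L .inr ℝ E W := by
    have h2 : HasFDerivAt (fun w : W => (x₀, w)) (ContinuousLinearMap.inr ℝ E W) w₀ :=
      hasFDerivAt_prodMk_right x₀ w₀
    exact (HasFDerivAt.comp w₀ (f := fun w : W => (x₀, w)) hd.hasFDerivAt h2).fderiv
  have hinv : (fderiv ℝ P (x₀, w₀) ∘L .inr ℝ E W).IsInvertible := by
    rw [← hfd]
    have hi : Function.Injective (fderiv ℝ (fun w => P (x₀, w)) w₀).toLinearMap := by
      rw [← LinearMap.ker_eq_bot, LinearMap.ker_eq_bot']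
      exact hinj
    refine ⟨(LinearEquiv.ofInjectiveEndo _ hi).toContinuousLinearEquiv, ?_⟩
    ext v
    rfl
  exact ⟨hP.implicitFunction (by simp) hinv, hP.contDiffAt_implicitFunction (by simp) hinv,
    hP.implicitFunction_apply_self (by simp) hinv,
    hP.eventually_apply_implicitFunction (by simp) hinv⟩

/-! ### Runge-Kutta steps for an ordinary differential equation: existence, uniqueness, smoothness
-/

section AbstractRK

variable {E : Type*} [NormedAddCommGroup E] [NormedSpace ℝ E] {s : ℕ}

/-- The right-hand side of the stage equations of a Runge-Kutta method for `y' = f y`. -/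
def rkStages (a : Matrix (Fin s) (Fin s) ℝ) (f : E → E) (h : ℝ) (x : E) (X : Fin s → E) :
    Fin s → E :=
  fun i => x + h • ∑ j, a i j • f (X j)

/-- The endpoint of a Runge-Kutta step for `y' = f y` with given stages. -/
def rkEnd (b : Fin s → ℝ) (f : E → E) (h : ℝ) (x : E) (X : Fin s → E) : E :=
  x + h • ∑ j, b j • f (X j)

theorem contDiff_rkStages (a : Matrix (Fin s) (Fin s) ℝ) {f : E → E} (hf : ContDiff ℝ ∞ f) :
    ContDiff ℝ ∞ (fun u : (ℝ × E) × (Fin s → E) => rkStages a f u.1.1 u.1.2 u.2) := by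
  unfold rkStages
  fun_prop

theorem contDiff_rkEnd (b : Fin s → ℝ) {f : E → E} (hf : ContDiff ℝ ∞ f) :
    ContDiff ℝ ∞ (fun u : (ℝ × E) × (Fin s → E) => rkEnd b f u.1.1 u.1.2 u.2) := by
  unfold rkEnd
  fun_prop

theorem norm_weighted_sum_le (c : Fin s → ℝ) {C : ℝ} {y : Fin s → E}
    (hy : ∀ j, ‖y j‖ ≤ C) : ‖∑ j, c j • y j‖ ≤ (∑ j, |c j|) * C := by
  rw [Finset.sum_mul]
  refine norm_sum_le_of_le _ fun j _ => ?_
  rw [norm_smul, Real.norm_eq_abs]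
  exact mul_le_mul_of_nonneg_left (hy j) (abs_nonneg _)

/-- A bound for the coefficients of a Runge-Kutta method. -/
def rkBound (a : Matrix (Fin s) (Fin s) ℝ) (b : Fin s → ℝ) : ℝ :=
  1 + ∑ i, ∑ j, |a i j| + ∑ j, |b j|

theorem rkBound_pos (a : Matrix (Fin s) (Fin s) ℝ) (b : Fin s → ℝ) : 0 < rkBound a b := by
  unfold rkBound
  positivity

theorem row_le_rkBound (a : Matrix (Fin s) (Fin s) ℝ) (b : Fin s → ℝ) (i : Fin s) :
    ∑ j, |a i j| ≤ rkBound a b := by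
  have h1 : ∑ j, |a i j| ≤ ∑ i, ∑ j, |a i j| :=
    Finset.single_le_sum (f := fun i => ∑ j, |a i j|) (fun i _ => by positivity)
      (Finset.mem_univ i)
  have h2 : 0 ≤ ∑ j, |b j| := by positivity
  unfold rkBound
  linarith

theorem weight_le_rkBound (a : Matrix (Fin s) (Fin s) ℝ) (b : Fin s → ℝ) :
    ∑ j, |b j| ≤ rkBound a b := by
  have h2 : 0 ≤ ∑ i, ∑ j, |a i j| := by positivity
  unfold rkBound
  linarith

theorem norm_rkStages_sub_le (a : Matrix (Fin s) (Fin s) ℝ) (b : Fin s → ℝ) {f : E → E} {C : ℝ}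
    (hC : 0 ≤ C) (h : ℝ) (x y : E) {X Y : Fin s → E} (hXY : ∀ j, ‖f (X j) - f (Y j)‖ ≤ C) :
    ‖rkStages a f h x X - rkStages a f h y Y‖ ≤ ‖x - y‖ + |h| * rkBound a b * C := by
  have hA := rkBound_pos a b
  rw [pi_norm_le_iff_of_nonneg (by positivity)]
  intro i
  have : (rkStages a f h x X - rkStages a f h y Y) i
      = (x - y) + h • ∑ j, a i j • (f (X j) - f (Y j)) := by
    simp only [rkStages, Pi.sub_apply, smul_sub, Finset.sum_sub_distrib]
    abel
  rw [this]
  refine (norm_add_le _ _).trans ?_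
  rw [norm_smul, Real.norm_eq_abs, mul_assoc]
  gcongr
  exact (norm_weighted_sum_le _ hXY).trans
    (mul_le_mul_of_nonneg_right (row_le_rkBound a b i) hC)

theorem norm_rkEnd_sub_le (a : Matrix (Fin s) (Fin s) ℝ) (b : Fin s → ℝ) {f : E → E} {C : ℝ}
    (hC : 0 ≤ C) (h : ℝ) (x y : E) {X Y : Fin s → E} (hXY : ∀ j, ‖f (X j) - f (Y j)‖ ≤ C) :
    ‖rkEnd b f h x X - rkEnd b f h y Y‖ ≤ ‖x - y‖ + |h| * rkBound a b * C := by
  have hA := rkBound_pos a b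
  have : rkEnd b f h x X - rkEnd b f h y Y
      = (x - y) + h • ∑ j, b j • (f (X j) - f (Y j)) := by
    simp only [rkEnd, smul_sub, Finset.sum_sub_distrib]
    abel
  rw [this]
  refine (norm_add_le _ _).trans ?_
  rw [norm_smul, Real.norm_eq_abs, mul_assoc]
  gcongr
  exact (norm_weighted_sum_le _ hXY).trans
    (mul_le_mul_of_nonneg_right (weight_le_rkBound a b) hC)

theorem norm_rkStages_sub_const_le (a : Matrix (Fin s) (Fin s) ℝ) (b : Fin s → ℝ) {f : E → E}
    {C : ℝ} (hC : 0 ≤ C) (h : ℝ) (x : E) {X : Fin s → E} (hX : ∀ j, ‖f (X j)‖ ≤ C) (i : Fin s) :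
    ‖rkStages a f h x X i - x‖ ≤ |h| * rkBound a b * C := by
  have : rkStages a f h x X i - x = h • ∑ j, a i j • f (X j) := by simp [rkStages]
  rw [this, norm_smul, Real.norm_eq_abs, mul_assoc]
  gcongr
  exact (norm_weighted_sum_le _ hX).trans
    (mul_le_mul_of_nonneg_right (row_le_rkBound a b i) hC)

/-- For small steps the stage equations have exactly one solution near the initial value. The
solution depends smoothly on the step and the initial value, and the one-step map is Lipschitz
with constant `1 + O(h)`. -/
theorem exists_rkSolution [FiniteDimensional ℝ E] (a : Matrix (Fin s) (Fin s) ℝ) (b : Fin s → ℝ)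
    {f : E → E} (hf : ContDiff ℝ ∞ f) (R δ : ℝ) (hδ : 0 < δ) :
    ∃ h₀ > 0, ∃ S : ℝ × E → (Fin s → E), ∃ Λ ≥ 0,
      ContDiffOn ℝ ∞ S (Ioo (-h₀) h₀ ×ˢ ball 0 R) ∧
      (∀ h ∈ Ioo (-h₀) h₀, ∀ x ∈ ball (0 : E) R, ∀ X : Fin s → E,
        (X = rkStages a f h x X ∧ ∀ i, ‖X i - x‖ ≤ δ) ↔ X = S (h, x)) ∧
      (∀ h ∈ Ioo (-h₀) h₀, ∀ x ∈ ball (0 : E) R, ∀ y ∈ ball (0 : E) R,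
        ‖rkEnd b f h x (S (h, x)) - rkEnd b f h y (S (h, y))‖ ≤ (1 + Λ * |h|) * ‖x - y‖) := by
  have : ProperSpace E := FiniteDimensional.proper_real E
  have : CompleteSpace E := FiniteDimensional.complete ℝ E
  set D : Set E := closedBall 0 (R + δ) with hD
  obtain ⟨K, hK⟩ := (hf.contDiffOn (s := D)).exists_lipschitzOnWith (by simp)
    (convex_closedBall _ _) (isCompact_closedBall _ _)
  obtain ⟨M, hM⟩ := (isCompact_closedBall (0 : E) (R + δ)).exists_bound_of_continuousOn
    hf.continuous.continuousOn
  set A := rkBound a b with hAdef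
  have hA : 0 < A := rkBound_pos a b
  -- The bound is made strictly positive because it is divided by in the threshold for the step.
  set M' := max M 0 + 1 with hM'
  have hM'0 : 0 < M' := by positivity
  have hfM : ∀ y ∈ D, ‖f y‖ ≤ M' := fun y hy =>
    (hM y hy).trans (by rw [hM']; linarith [le_max_left M 0])
  -- The first threshold keeps the stages within `δ` of the initial value, the second makes the
  -- stage map a contraction with factor 1/2.
  set h₀ := min (δ / (2 * A * M')) (1 / (2 * A * (K + 1))) with hh₀
  have hh₀pos : 0 < h₀ := by positivity
  have step1 : ∀ h ∈ Ioo (-h₀) h₀, |h| * A * M' < δ := by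
    intro h hh
    have h1 : |h| < δ / (2 * A * M') := (abs_lt.2 hh).trans_le (min_le_left _ _)
    rw [lt_div_iff₀ (by positivity)] at h1
    nlinarith
  have step2 : ∀ h ∈ Ioo (-h₀) h₀, |h| * A * K ≤ 1 / 2 := by
    intro h hh
    have h1 : |h| < 1 / (2 * A * (K + 1)) := (abs_lt.2 hh).trans_le (min_le_right _ _)
    rw [lt_div_iff₀ (by positivity)] at h1
    nlinarith [mul_nonneg (abs_nonneg h) hA.le]
  have hmem : ∀ x ∈ ball (0 : E) R, ∀ y, ‖y - x‖ ≤ δ → y ∈ D := by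
    intro x hx y hy
    rw [mem_ball_zero_iff] at hx
    rw [hD, mem_closedBall_zero_iff]
    calc ‖y‖ = ‖(y - x) + x‖ := by simp
      _ ≤ ‖y - x‖ + ‖x‖ := norm_add_le _ _
      _ ≤ R + δ := by linarith
  have hlip : ∀ X Y : Fin s → E, (∀ i, X i ∈ D) → (∀ i, Y i ∈ D) →
      ∀ j, ‖f (X j) - f (Y j)‖ ≤ K * ‖X - Y‖ := by
    intro X Y hX hY j
    have := hK.dist_le_mul _ (hX j) _ (hY j)
    rw [dist_eq_norm, dist_eq_norm] at this
    exact this.trans (mul_le_mul_of_nonneg_left (norm_le_pi_norm (X - Y) j) K.2)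
  have hstab : ∀ h ∈ Ioo (-h₀) h₀, ∀ x y, ∀ X Y : Fin s → E, (∀ i, X i ∈ D) → (∀ i, Y i ∈ D) →
      ‖rkStages a f h x X - rkStages a f h y Y‖ ≤ ‖x - y‖ + 1 / 2 * ‖X - Y‖ := by
    intro h hh x y X Y hX hY
    refine (norm_rkStages_sub_le a b (by positivity) h x y (hlip X Y hX hY)).trans ?_
    have := mul_le_mul_of_nonneg_right (step2 h hh) (norm_nonneg (X - Y))
    linarith
  have hfix : ∀ h ∈ Ioo (-h₀) h₀, ∀ x y, ∀ X Y : Fin s → E, (∀ i, X i ∈ D) → (∀ i, Y i ∈ D) →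
      X = rkStages a f h x X → Y = rkStages a f h y Y → ‖X - Y‖ ≤ 2 * ‖x - y‖ := by
    intro h hh x y X Y hX hY h1 h2
    have := hstab h hh x y X Y hX hY
    rw [← h1, ← h2] at this
    linarith
  -- The strict inequality makes the selection of stages an open condition, which the smoothness
  -- argument needs.
  have hstrict : ∀ h ∈ Ioo (-h₀) h₀, ∀ x, ∀ X : Fin s → E, (∀ i, X i ∈ D) →
      ∀ i, ‖rkStages a f h x X i - x‖ < δ := fun h hh x X hX i =>
    (norm_rkStages_sub_const_le a b hM'0.le h x (fun j => hfM _ (hX j)) i).trans_lt (step1 h hh)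
  have hex : ∀ u : ℝ × E, ∃ X : Fin s → E, u.1 ∈ Ioo (-h₀) h₀ → u.2 ∈ ball (0 : E) R →
      X = rkStages a f u.1 u.2 X ∧ ∀ i, ‖X i - u.2‖ ≤ δ := by
    rintro ⟨h, x⟩
    by_cases hh : h ∈ Ioo (-h₀) h₀
    swap
    · exact ⟨0, fun h1 => absurd h1 hh⟩
    by_cases hx : x ∈ ball (0 : E) R
    swap
    · exact ⟨0, fun _ h1 => absurd h1 hx⟩
    set Q : Set (Fin s → E) := {X | ∀ i, ‖X i - x‖ ≤ δ} with hQ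
    have hQc : IsClosed Q := by
      rw [hQ, ofPred_forall]
      exact isClosed_iInter fun i => isClosed_le (by fun_prop) continuous_const
    have hQD : ∀ X ∈ Q, ∀ i, X i ∈ D := fun X hX i => hmem x hx _ (hX i)
    have hmaps : MapsTo (rkStages a f h x) Q Q := fun X hX i =>
      (hstrict h hh x X (hQD X hX) i).le
    have hcon : ContractingWith (1 / 2) (hmaps.restrict _ Q Q) := by
      refine ⟨by rw [← NNReal.coe_lt_coe]; norm_num, LipschitzWith.of_dist_le_mul ?_⟩
      rintro ⟨X, hX⟩ ⟨Y, hY⟩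
      have := hstab h hh x x X Y (hQD X hX) (hQD Y hY)
      rw [sub_self, norm_zero, zero_add, ← dist_eq_norm, ← dist_eq_norm] at this
      simpa [Subtype.dist_eq] using this
    obtain ⟨X, hX, hXfix, -⟩ := hcon.exists_fixedPoint' hQc.isComplete hmaps
      (x := fun _ => x) (by simp [hQ, hδ.le]) (edist_ne_top _ _)
    exact ⟨X, fun _ _ => ⟨hXfix.symm, hX⟩⟩
  choose S hS using hex
  have huniq : ∀ h ∈ Ioo (-h₀) h₀, ∀ x ∈ ball (0 : E) R, ∀ X : Fin s → E,
        (X = rkStages a f h x X ∧ ∀ i, ‖X i - x‖ ≤ δ) ↔ X = S (h, x) := by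
    intro h hh x hx X
    have hSx := hS (h, x) hh hx
    constructor
    · rintro ⟨h1, h2⟩
      have := hfix h hh x x X (S (h, x)) (fun i => hmem x hx _ (h2 i))
        (fun i => hmem x hx _ (hSx.2 i)) h1 hSx.1
      rw [sub_self, norm_zero, mul_zero] at this
      exact sub_eq_zero.1 (norm_le_zero_iff.1 this)
    · rintro rfl
      exact hSx
  refine ⟨h₀, hh₀pos, S, 2 * A * K, by positivity, ?_, huniq, ?_⟩
  · rintro ⟨h, x⟩ ⟨hh, hx⟩
    simp only at hh hx
    refine ContDiffAt.contDiffWithinAt ?_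
    have hSx := hS (h, x) hh hx
    have hSD : ∀ i, S (h, x) i ∈ D := fun i => hmem x hx _ (hSx.2 i)
    have hnear : ∀ᶠ X in 𝓝 (S (h, x)), ∀ i, ‖X i - x‖ < δ := by
      rw [eventually_all]
      intro i
      have : Continuous fun X : Fin s → E => ‖X i - x‖ := by fun_prop
      refine this.continuousAt.eventually_lt continuousAt_const ?_
      have := hstrict h hh x _ hSD i
      rwa [← hSx.1] at this
    set P : (ℝ × E) × (Fin s → E) → (Fin s → E) :=
      fun u => u.2 - rkStages a f u.1.1 u.1.2 u.2 with hP
    have hPs : ContDiff ℝ ∞ P := contDiff_snd.sub (contDiff_rkStages a hf)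
    have hP0 : P ((h, x), S (h, x)) = 0 := by
      simp only [hP]
      exact sub_eq_zero.2 hSx.1
    have hTd : Differentiable ℝ (rkStages a f h x) := by
      have h1 : ContDiff ℝ ∞ (fun X => rkStages a f h x X) :=
        (contDiff_rkStages a hf).comp (contDiff_const (c := (h, x)) |>.prodMk contDiff_id)
      exact h1.differentiable (by simp)
    obtain ⟨φ, hφ, hφ0, hφP⟩ := exists_contDiffAt_implicit (P := P) (x₀ := (h, x))
      (w₀ := S (h, x)) hPs.contDiffAt (by
        intro v hv
        have h1 : fderiv ℝ (fun X => P ((h, x), X)) (S (h, x)) v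
            = v - fderiv ℝ (rkStages a f h x) (S (h, x)) v := by
          simp only [hP]
          rw [fderiv_fun_sub differentiableAt_fun_id hTd.differentiableAt]
          simp
        rw [h1, sub_eq_zero] at hv
        -- A derivative of norm at most 1/2 has no nonzero fixed vector, so the derivative of `X -
        -- rkStages a f h x X` is injective.
        have h2 : ‖fderiv ℝ (rkStages a f h x) (S (h, x))‖ ≤ ((1 / 2 : NNReal) : ℝ) := by
          refine norm_fderiv_le_of_lipschitzOn ℝ (s := {X : Fin s → E | ∀ i, ‖X i - x‖ < δ})
            hnear ?_
          refine LipschitzOnWith.of_dist_le_mul fun X hX Y hY => ?_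
          have := hstab h hh x x X Y (fun i => hmem x hx _ (hX i).le)
            (fun i => hmem x hx _ (hY i).le)
          rw [sub_self, norm_zero, zero_add, ← dist_eq_norm, ← dist_eq_norm] at this
          simpa using this
        have h3 := ContinuousLinearMap.le_of_opNorm_le _ h2 v
        rw [← hv] at h3
        have h4 : ‖v‖ ≤ 0 := by
          push_cast at h3
          linarith
        exact norm_le_zero_iff.1 h4)
    -- The implicit branch stays within `δ` of the initial value, so uniqueness identifies it with
    -- the chosen solution `S`.
    refine hφ.congr_of_eventuallyEq ?_
    have hO : Ioo (-h₀) h₀ ×ˢ ball (0 : E) R ∈ 𝓝 (h, x) :=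
      (isOpen_Ioo.prod isOpen_ball).mem_nhds ⟨hh, hx⟩
    have hclose : ∀ᶠ u in 𝓝 (h, x), ∀ i, ‖φ u i - u.2‖ < δ := by
      rw [eventually_all]
      intro i
      have hc : ContinuousAt (fun u : ℝ × E => ‖φ u i - u.2‖) (h, x) := by
        have h1 : ContinuousAt (fun u => φ u i) (h, x) :=
          (continuous_apply i).continuousAt.comp hφ.continuousAt
        exact (h1.sub continuousAt_snd).norm
      refine hc.eventually_lt continuousAt_const ?_
      rw [hφ0]
      have := hstrict h hh x _ hSD i
      rwa [← hSx.1] at this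
    filter_upwards [hO, hclose, hφP] with u hu hu1 hu2
    symm
    refine (huniq u.1 hu.1 u.2 hu.2 (φ u)).1 ⟨?_, fun i => (hu1 i).le⟩
    rw [hP0] at hu2
    exact sub_eq_zero.1 hu2
  · intro h hh x hx y hy
    have hSx := hS (h, x) hh hx
    have hSy := hS (h, y) hh hy
    have hSxD : ∀ i, S (h, x) i ∈ D := fun i => hmem x hx _ (hSx.2 i)
    have hSyD : ∀ i, S (h, y) i ∈ D := fun i => hmem y hy _ (hSy.2 i)
    have h1 := hfix h hh x y _ _ hSxD hSyD hSx.1 hSy.1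
    have h2 : ∀ j, ‖f (S (h, x) j) - f (S (h, y) j)‖ ≤ K * (2 * ‖x - y‖) := fun j =>
      (hlip _ _ hSxD hSyD j).trans (mul_le_mul_of_nonneg_left h1 K.2)
    refine (norm_rkEnd_sub_le a b (by positivity) h x y h2).trans (le_of_eq ?_)
    ring

end AbstractRK

/-! ### Preservation of bilinear invariants -/

section SymplecticRK

variable {E : Type*} [NormedAddCommGroup E] [NormedSpace ℝ E] {s : ℕ}

/-- Expand the left side and trade `u`, `v` in the terms linear in `h` for the stages `U i`, `V i`.
The stage terms cancel by `hkl`, and the remaining `h ^ 2` terms have coefficients `b i * b j - b j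
* a j i - b i * a i j`, which vanish. -/
theorem IsSymplecticRK.bilinear_invariant {a : Matrix (Fin s) (Fin s) ℝ} {b : Fin s → ℝ}
    (hab : IsSymplecticRK a b) (σ : E →L[ℝ] E →L[ℝ] ℝ) (h : ℝ) (u v : E)
    (U V k l : Fin s → E) (hU : ∀ i, U i = u + h • ∑ j, a i j • k j)
    (hV : ∀ i, V i = v + h • ∑ j, a i j • l j) (hkl : ∀ i, σ (k i) (V i) + σ (U i) (l i) = 0) :
    σ (u + h • ∑ j, b j • k j) (v + h • ∑ j, b j • l j) = σ u v := by
  have h1 : ∀ i, σ (k i) v = σ (k i) (V i) - h * ∑ j, a i j * σ (k i) (l j) := by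
    intro i
    rw [hV i]
    simp [map_sum]
  have h2 : ∀ j, σ u (l j) = σ (U j) (l j) - h * ∑ i, a j i * σ (k i) (l j) := by
    intro j
    rw [hU j]
    simp [map_sum]
  have h3 : σ (u + h • ∑ j, b j • k j) (v + h • ∑ j, b j • l j)
      = σ u v + h * ∑ j, b j * σ u (l j) + h * ∑ i, b i * σ (k i) v
        + h * (h * ∑ i, ∑ j, b i * b j * σ (k i) (l j)) := by
    simp only [map_add, map_smul, map_sum, add_apply,
      smul_apply, sum_apply, smul_eq_mul,
      Finset.mul_sum, mul_add, Finset.sum_add_distrib]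
    rw [Finset.sum_comm]
    have : ∀ i j, h * (b j * (h * (b i * σ (k i) (l j))))
        = h * (h * (b i * b j * σ (k i) (l j))) := fun i j => by ring
    simp only [this]
    ring
  have h4 : ∑ j, b j * σ u (l j) + ∑ i, b i * σ (k i) v
      = - (h * ∑ i, ∑ j, (b j * a j i + b i * a i j) * σ (k i) (l j)) := by
    simp only [h1, h2, mul_sub, Finset.sum_sub_distrib, add_mul, Finset.sum_add_distrib, mul_add]
    have e1 : ∑ i, ∑ j, b j * a j i * σ (k i) (l j)
        = ∑ j, b j * ∑ i, a j i * σ (k i) (l j) := by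
      rw [Finset.sum_comm]
      simp only [Finset.mul_sum, mul_assoc]
    have e2 : ∑ i, ∑ j, b i * a i j * σ (k i) (l j)
        = ∑ i, b i * ∑ j, a i j * σ (k i) (l j) := by
      simp only [Finset.mul_sum, mul_assoc]
    have e3 : ∑ i, b i * σ (U i) (l i) + ∑ i, b i * σ (k i) (V i) = 0 := by
      rw [← Finset.sum_add_distrib]
      refine Finset.sum_eq_zero fun i _ => ?_
      rw [← mul_add, add_comm, hkl, mul_zero]
    have e4 : ∀ c : Fin s → ℝ, ∑ i, b i * (h * c i) = h * ∑ i, b i * c i := fun c => by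
      rw [Finset.mul_sum]
      exact Finset.sum_congr rfl fun i _ => by ring
    rw [e1, e2, e4, e4]
    linarith
  have h5 : ∑ i, ∑ j, b i * b j * σ (k i) (l j)
      = ∑ i, ∑ j, (b j * a j i + b i * a i j) * σ (k i) (l j) := by
    refine Finset.sum_congr rfl fun i _ => Finset.sum_congr rfl fun j _ => ?_
    have := hab i j
    rw [show b i * b j = b j * a j i + b i * a i j by linarith]
  rw [h3, h5]
  linear_combination h * h4

/-- Differentiating the stage equations shows that tangent vectors are propagated by the same method
applied to the variational equation; `hσ` says that `σ` is an invariant of that equation. -/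
theorem IsSymplecticRK.fderiv_rkEnd_invariant {a : Matrix (Fin s) (Fin s) ℝ} {b : Fin s → ℝ}
    (hab : IsSymplecticRK a b) (σ : E →L[ℝ] E →L[ℝ] ℝ) {f : E → E} (hf : ContDiff ℝ ∞ f)
    (hσ : ∀ x u v, σ (fderiv ℝ f x u) v + σ u (fderiv ℝ f x v) = 0) (h : ℝ) {x : E}
    {S : E → (Fin s → E)} (hS : DifferentiableAt ℝ S x)
    (hSx : ∀ᶠ y in 𝓝 x, S y = rkStages a f h y (S y)) (u v : E) :
    σ (fderiv ℝ (fun y => rkEnd b f h y (S y)) x u) (fderiv ℝ (fun y => rkEnd b f h y (S y)) x v)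
      = σ u v := by
  have hSi : ∀ i, HasFDerivAt (fun y => S y i)
      ((ContinuousLinearMap.proj i).comp (fderiv ℝ S x)) x := fun i =>
    (ContinuousLinearMap.proj (R := ℝ) (φ := fun _ : Fin s => E) i).hasFDerivAt.comp x
      hS.hasFDerivAt
  have hfS : ∀ i, HasFDerivAt (fun y => f (S y i))
      ((fderiv ℝ f (S x i)).comp ((ContinuousLinearMap.proj i).comp (fderiv ℝ S x))) x := fun i =>
    ((hf.differentiable (by simp)).differentiableAt.hasFDerivAt).comp x (hSi i)
  have hsum : ∀ c : Fin s → ℝ, HasFDerivAt (fun y => y + h • ∑ j, c j • f (S y j))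
      (ContinuousLinearMap.id ℝ E + h • ∑ j, c j •
        ((fderiv ℝ f (S x j)).comp ((ContinuousLinearMap.proj j).comp (fderiv ℝ S x)))) x :=
    fun c => (hasFDerivAt_id x).add
      ((HasFDerivAt.fun_sum fun j _ => (hfS j).const_smul (c j)).const_smul h)
  have hend : ∀ w, fderiv ℝ (fun y => rkEnd b f h y (S y)) x w
      = w + h • ∑ j, b j • fderiv ℝ f (S x j) (fderiv ℝ S x w j) := by
    intro w
    rw [show (fun y => rkEnd b f h y (S y)) = fun y => y + h • ∑ j, b j • f (S y j) from rfl,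
      (hsum b).fderiv]
    simp
  have hstage : ∀ w i, fderiv ℝ S x w i
      = w + h • ∑ j, a i j • fderiv ℝ f (S x j) (fderiv ℝ S x w j) := by
    intro w i
    have h1 : HasFDerivAt (fun y => S y i) _ x := (hsum (a i)).congr_of_eventuallyEq
      (hSx.mono fun y hy => congrFun hy i)
    have h2 := congrArg (fun T : E →L[ℝ] E => T w) ((hSi i).unique h1)
    simpa [sum_apply] using h2
  rw [hend, hend]
  exact hab.bilinear_invariant σ h u v _ _ _ _ (hstage u) (hstage v) fun i => hσ _ _ _

end SymplecticRK

/-! ### From pointwise to uniform order of vanishing -/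

section UniformTaylor

variable {F : Type*} [NormedAddCommGroup F] [NormedSpace ℝ F]

/-- The first nonzero Taylor term, at an order `j < m`, would dominate the bound `B * h ^ m`. The
comparison is one-sided because the order condition concerns positive steps only. -/
theorem iteratedDeriv_eq_zero_of_norm_le_pow {f : ℝ → F} {η : ℝ} (hη : 0 < η)
    (hf : ContDiffOn ℝ ∞ f (Ioo (-η) η)) {m : ℕ} {B ε : ℝ} (hε : 0 < ε)
    (hB : ∀ h, 0 < h → h ≤ ε → ‖f h‖ ≤ B * h ^ m) : ∀ j < m, iteratedDeriv j f 0 = 0 := by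
  have h0 : (0 : ℝ) ∈ Ioo (-η) η := by constructor <;> linarith
  intro j
  induction j using Nat.strong_induction_on with
  | _ j ih =>
    intro hj
    have hT := taylor_isLittleO (convex_Ioo (-η) η) h0 (contDiffOn_infty.1 hf j)
    -- The lower coefficients vanish by induction, so only the top Taylor term survives.
    have hval : ∀ x, taylorWithinEval f j (Ioo (-η) η) 0 x
        = (((j.factorial : ℝ)⁻¹) * x ^ j) • iteratedDeriv j f 0 := by
      intro x
      rw [taylor_within_apply, Finset.sum_range_succ, Finset.sum_eq_zero, zero_add, sub_zero,
        iteratedDerivWithin_of_isOpen isOpen_Ioo h0]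
      intro i hi
      rw [iteratedDerivWithin_of_isOpen isOpen_Ioo h0, ih i (Finset.mem_range.1 hi)
        ((Finset.mem_range.1 hi).trans hj), smul_zero]
    rw [isOpen_Ioo.nhdsWithin_eq h0] at hT
    have hT' := hT.mono (nhdsWithin_le_nhds (s := Ioi (0 : ℝ)))
    have hfo : f =o[𝓝[>] 0] fun x : ℝ => x ^ j := by
      have h1 : f =O[𝓝[>] 0] fun x : ℝ => x ^ m := by
        refine Asymptotics.IsBigO.of_bound B ?_
        filter_upwards [Ioc_mem_nhdsGT hε] with x hx
        rw [Real.norm_of_nonneg (pow_nonneg hx.1.le _)]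
        exact hB x hx.1 hx.2
      refine h1.trans_isLittleO ?_
      exact (Asymptotics.isLittleO_pow_pow (𝕜 := ℝ) hj).mono nhdsWithin_le_nhds
    have hdiff := hfo.sub (by simpa only [sub_zero] using hT')
    have hpow : (fun x : ℝ => x ^ j • iteratedDeriv j f 0) =o[𝓝[>] 0] fun x : ℝ => x ^ j := by
      have h2 := hdiff.const_smul_left (j.factorial : ℝ)
      refine h2.congr (fun x => ?_) fun _ => rfl
      have hfac : (j.factorial : ℝ) ≠ 0 := by positivity
      simp only [Pi.smul_apply, sub_sub_cancel]
      rw [hval, smul_smul]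
      congr 1
      field_simp
    by_contra hne
    have h6 : 0 < ‖iteratedDeriv j f 0‖ := norm_pos_iff.2 hne
    have h3 := hpow.def (half_pos h6)
    have h4 : ∀ᶠ x in 𝓝[>] (0 : ℝ), 0 < x := self_mem_nhdsWithin
    obtain ⟨x, hx, hx0⟩ := (h3.and h4).exists
    rw [norm_smul] at hx
    have h5 : 0 < ‖x ^ j‖ := norm_pos_iff.2 (pow_ne_zero _ hx0.ne')
    nlinarith

/-- If all derivatives up to order `m - 1` in the second variable vanish on a compact interval,
the function is `O(h ^ m)` uniformly on the interval. -/
theorem exists_uniform_bound_of_iteratedDeriv_eq_zero {t₀ t₁ α β η : ℝ} (hα : α < t₀) (hβ : t₁ < β)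
    (hη : 0 < η) (m : ℕ) : ∀ {G : ℝ × ℝ → F}, ContDiffOn ℝ ∞ G (Ioo α β ×ˢ Ioo (-η) η) →
    (∀ j < m, ∀ t ∈ Icc t₀ t₁, iteratedDeriv j (fun h => G (t, h)) 0 = 0) →
    ∃ B ≥ 0, ∀ t ∈ Icc t₀ t₁, ∀ h ∈ Icc 0 (η / 2), ‖G (t, h)‖ ≤ B * h ^ m := by
  have hsub : ∀ t ∈ Icc t₀ t₁, t ∈ Ioo α β := fun t ht =>
    ⟨hα.trans_le ht.1, ht.2.trans_lt hβ⟩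
  have hsub' : ∀ h ∈ Icc 0 (η / 2), h ∈ Ioo (-η) η := fun h hh =>
    ⟨by linarith [hh.1], by linarith [hh.2]⟩
  have hO : IsOpen (Ioo α β ×ˢ Ioo (-η) η) := isOpen_Ioo.prod isOpen_Ioo
  induction m with
  | zero =>
    intro G hG _
    obtain ⟨C, hC⟩ := (isCompact_Icc.prod isCompact_Icc).exists_bound_of_continuousOn
      (hG.continuousOn.mono (prod_mono hsub hsub'))
    refine ⟨max C 0, le_max_right _ _, fun t ht h hh => ?_⟩
    rw [pow_zero, mul_one]
    exact (hC (t, h) ⟨ht, hh⟩).trans (le_max_left _ _)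
  | succ m ih =>
    intro G hG hz
    have hder : ∀ t ∈ Ioo α β, ∀ h ∈ Ioo (-η) η,
        HasDerivAt (fun h => G (t, h)) (fderiv ℝ G (t, h) (0, 1)) h := by
      intro t ht h hh
      have h1 : HasFDerivAt G (fderiv ℝ G (t, h)) (t, h) :=
        ((hG.contDiffAt (hO.mem_nhds ⟨ht, hh⟩)).differentiableAt (by simp)).hasFDerivAt
      exact h1.comp_hasDerivAt h ((hasDerivAt_const h t).prodMk (hasDerivAt_id h))
    have hG' : ContDiffOn ℝ ∞ (fun p : ℝ × ℝ => deriv (fun h => G (p.1, h)) p.2)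
        (Ioo α β ×ˢ Ioo (-η) η) := by
      have h1 : ContDiffOn ℝ ∞ (fun p => fderiv ℝ G p (0, 1)) (Ioo α β ×ˢ Ioo (-η) η) :=
        (hG.fderiv_of_isOpen hO (by simp)).clm_apply contDiffOn_const
      exact h1.congr fun p hp => (hder p.1 hp.1 p.2 hp.2).deriv
    -- The induction hypothesis is applied to `∂G/∂h`; the mean value inequality on `[0, h]` then
    -- gains one power of `h`, since `G (t, 0) = 0`.
    obtain ⟨B, hB0, hB⟩ := ih hG' fun j hj t ht => by
      have := hz (j + 1) (by omega) t ht
      rwa [iteratedDeriv_succ'] at this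
    refine ⟨B, hB0, fun t ht h hh => ?_⟩
    have hmv := Convex.norm_image_sub_le_of_norm_hasDerivWithin_le (f := fun h => G (t, h))
      (f' := fun h => fderiv ℝ G (t, h) (0, 1)) (s := Icc 0 h) (C := B * h ^ m) (x := 0) (y := h)
      (fun y hy => (hder t (hsub t ht) y
        (hsub' y ⟨hy.1, hy.2.trans hh.2⟩)).hasDerivWithinAt)
      (fun y hy => by
        have hy' : y ∈ Icc 0 (η / 2) := ⟨hy.1, hy.2.trans hh.2⟩
        rw [← (hder t (hsub t ht) y (hsub' y hy')).deriv]
        refine (hB t ht y hy').trans ?_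
        exact mul_le_mul_of_nonneg_left (pow_le_pow_left₀ hy.1 hy.2 m) hB0)
      (convex_Icc 0 h) (left_mem_Icc.2 hh.1) (right_mem_Icc.2 hh.1)
    have h0 : G (t, 0) = 0 := by simpa using hz 0 (by omega) t ht
    rw [h0, sub_zero, sub_zero, Real.norm_of_nonneg hh.1] at hmv
    rw [pow_succ, ← mul_assoc]
    exact hmv

/-- A smooth function of `(t, h)` that is `O(h ^ m)` for each fixed `t` in a compact interval is
`O(h ^ m)` uniformly. -/
theorem exists_uniform_bound_of_pointwise {t₀ t₁ α β η : ℝ} (hα : α < t₀) (hβ : t₁ < β)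
    (hη : 0 < η) (m : ℕ) {G : ℝ × ℝ → F} (hG : ContDiffOn ℝ ∞ G (Ioo α β ×ˢ Ioo (-η) η))
    (hp : ∀ t ∈ Icc t₀ t₁, ∃ B : ℝ, ∃ ε > 0, ∀ h, 0 < h → h ≤ ε → ‖G (t, h)‖ ≤ B * h ^ m) :
    ∃ B ≥ 0, ∀ t ∈ Icc t₀ t₁, ∀ h ∈ Icc 0 (η / 2), ‖G (t, h)‖ ≤ B * h ^ m := by
  refine exists_uniform_bound_of_iteratedDeriv_eq_zero hα hβ hη m hG fun j hj t ht => ?_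
  obtain ⟨B, ε, hε, hB⟩ := hp t ht
  refine iteratedDeriv_eq_zero_of_norm_le_pow hη ?_ hε hB j hj
  exact hG.comp (contDiffOn_const.prodMk contDiffOn_id) fun h hh =>
    ⟨⟨hα.trans_le ht.1, ht.2.trans_lt hβ⟩, hh⟩

end UniformTaylor

/-! ### Extension and smoothness of solutions -/

section ODE

variable {E : Type*} [NormedAddCommGroup E] [NormedSpace ℝ E]

theorem HasDerivWithinAt.hasDerivAt_ite {y z : ℝ → E} {d : E} {c : ℝ}
    (hy : HasDerivWithinAt y d (Iic c) c) (hz : HasDerivWithinAt z d (Ici c) c) (hyz : y c = z c) :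
    HasDerivAt (fun t => if t ≤ c then y t else z t) d c := by
  rw [← hasDerivWithinAt_univ, ← Iic_union_Ici (a := c)]
  refine HasDerivWithinAt.union ?_ ?_
  · exact hy.congr (fun t ht => if_pos ht) (if_pos le_rfl)
  · refine hz.congr (fun t ht => ?_) (by simp [hyz])
    rcases eq_or_lt_of_le (mem_Ici.1 ht) with rfl | h
    · simp [hyz]
    · rw [if_neg (not_le.2 h)]

/-- Local solutions through the two end values are glued on. This puts the compact interval inside
an open one, as needed both for the two-sided order condition and for smoothness of the error in
`(t, h)`. -/
theorem exists_extension_of_hasDerivWithinAt [CompleteSpace E] {f : E → E} (hf : ContDiff ℝ ∞ f)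
    {t₀ t₁ : ℝ} (ht : t₀ < t₁) {x : ℝ → E}
    (hx : ∀ t ∈ Icc t₀ t₁, HasDerivWithinAt x (f (x t)) (Icc t₀ t₁) t) :
    ∃ X : ℝ → E, EqOn X x (Icc t₀ t₁) ∧ ∃ ε > 0, ∀ t ∈ Ioo (t₀ - ε) (t₁ + ε),
      HasDerivAt X (f (X t)) t := by
  have hf1 : ∀ x, ContDiffAt ℝ 1 f x := fun x => (hf.of_le (by simp)).contDiffAt
  obtain ⟨y, hy0, ε₀, hε₀, hy⟩ :=
    (hf1 (x t₀)).exists_forall_mem_closedBall_exists_eq_forall_mem_Ioo_hasDerivAt₀ t₀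
  obtain ⟨z, hz0, ε₁, hε₁, hz⟩ :=
    (hf1 (x t₁)).exists_forall_mem_closedBall_exists_eq_forall_mem_Ioo_hasDerivAt₀ t₁
  set X : ℝ → E := fun t => if t ≤ t₀ then y t else if t ≤ t₁ then x t else z t with hX
  have hXx : EqOn X x (Icc t₀ t₁) := by
    intro t hmem
    rcases eq_or_lt_of_le hmem.1 with rfl | h
    · simp [hX, hy0]
    · simp [hX, not_le.2 h, hmem.2]
  refine ⟨X, hXx, min ε₀ ε₁, lt_min hε₀ hε₁, fun t htI => ?_⟩
  have hm0 := min_le_left ε₀ ε₁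
  have hm1 := min_le_right ε₀ ε₁
  have hx1 : HasDerivAt (fun t => if t ≤ t₁ then x t else z t) (f (x t₁)) t₁ := by
    refine HasDerivWithinAt.hasDerivAt_ite ?_ ?_ hz0.symm
    · exact (hx t₁ (right_mem_Icc.2 ht.le)).mono_of_mem_nhdsWithin (Icc_mem_nhdsLE ht)
    · have := hz t₁ ⟨by linarith, by linarith⟩
      rw [hz0] at this
      exact this.hasDerivWithinAt
  rcases lt_trichotomy t t₀ with h | rfl | h
  · have : X =ᶠ[𝓝 t] y := by
      filter_upwards [Iio_mem_nhds h] with u hu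
      exact if_pos (le_of_lt hu)
    rw [this.eq_of_nhds]
    exact (hy t ⟨by linarith [htI.1], by linarith⟩).congr_of_eventuallyEq this
  · rw [hXx (left_mem_Icc.2 ht.le)]
    refine HasDerivWithinAt.hasDerivAt_ite ?_ ?_ (by simp [hy0, ht.le])
    · have := hy t ⟨by linarith, by linarith⟩
      rw [hy0] at this
      exact this.hasDerivWithinAt
    · have h1 := (hx t (left_mem_Icc.2 ht.le)).mono_of_mem_nhdsWithin (Icc_mem_nhdsGE ht)
      refine h1.congr_of_eventuallyEq ?_ (by simp [ht.le])
      filter_upwards [nhdsWithin_le_nhds (Iio_mem_nhds ht)] with u hu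
      exact if_pos (le_of_lt hu)
  · have hX1 : X =ᶠ[𝓝 t] fun t => if t ≤ t₁ then x t else z t := by
      filter_upwards [Ioi_mem_nhds h] with u hu
      exact if_neg (not_le.2 hu)
    refine HasDerivAt.congr_of_eventuallyEq ?_ hX1
    rcases lt_trichotomy t t₁ with h' | rfl | h'
    · have h2 := (hx t ⟨h.le, h'.le⟩).hasDerivAt (Icc_mem_nhds h h')
      rw [hXx ⟨h.le, h'.le⟩]
      refine h2.congr_of_eventuallyEq ?_
      filter_upwards [Iio_mem_nhds h'] with u hu
      exact if_pos (le_of_lt hu)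
    · rw [hXx ⟨h.le, le_rfl⟩]
      exact hx1
    · have h3 : (fun t => if t ≤ t₁ then x t else z t) =ᶠ[𝓝 t] z := by
        filter_upwards [Ioi_mem_nhds h'] with u hu
        exact if_neg (not_le.2 hu)
      rw [(hX1.trans h3).eq_of_nhds]
      exact (hz t ⟨by linarith, by linarith [htI.2]⟩).congr_of_eventuallyEq h3

/-- Bootstrapping: if `x` is `C^n`, then so is `x' = f ∘ x`, hence `x` is `C^(n+1)`. -/
theorem contDiffOn_of_hasDerivAt_comp {f : E → E} (hf : ContDiff ℝ ∞ f) {I : Set ℝ}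
    (hI : IsOpen I) {x : ℝ → E} (hx : ∀ t ∈ I, HasDerivAt x (f (x t)) t) :
    ContDiffOn ℝ ∞ x I := by
  rw [contDiffOn_infty]
  intro n
  induction n with
  | zero =>
    rw [Nat.cast_zero, contDiffOn_zero]
    exact fun t ht => (hx t ht).continuousAt.continuousWithinAt
  | succ n ih =>
    push_cast
    rw [contDiffOn_succ_iff_deriv_of_isOpen hI]
    refine ⟨fun t ht => (hx t ht).differentiableAt.differentiableWithinAt, by simp, ?_⟩
    have : ContDiffOn ℝ n (fun t => f (x t)) I :=
      (hf.of_le (by exact_mod_cast le_top)).comp_contDiffOn ih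
    exact this.congr fun t ht => (hx t ht).deriv

end ODE

/-- Discrete Grönwall argument: each step multiplies the old error by at most `1 + Λ h ≤ exp (Λ h)`
and adds `B h ^ (r + 1)`. The Lipschitz bound is available only in the ball, so the error estimate
and membership in the ball are propagated together; `hsmall` keeps the deviation below 1. -/
theorem global_error_bound {E : Type*} [NormedAddCommGroup E] {Ψ : E → E} {x : ℕ → E}
    {N : ℕ} {ξ : ℕ → E} {R B Λ h T : ℝ} {r : ℕ}
    (hh : 0 ≤ h) (hB : 0 ≤ B) (hΛ : 0 ≤ Λ) (hT : N * h ≤ T) (hx : ∀ m ≤ N, ‖x m‖ < R)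
    (hlip : ∀ u ∈ ball (0 : E) (R + 1), ∀ v ∈ ball (0 : E) (R + 1),
      ‖Ψ u - Ψ v‖ ≤ (1 + Λ * h) * ‖u - v‖)
    (hloc : ∀ m < N, ‖Ψ (x m) - x (m + 1)‖ ≤ B * h ^ (r + 1))
    (hsmall : T * B * Real.exp (Λ * T) * h ^ r ≤ 1 / 2) (h0 : ξ 0 = x 0)
    (hξ : ∀ m < N, ξ m ∈ ball (0 : E) (R + 1) → ξ (m + 1) = Ψ (ξ m)) :
    ∀ m ≤ N, ‖ξ m - x m‖ ≤ T * B * Real.exp (Λ * T) * h ^ r ∧ ξ m ∈ ball (0 : E) (R + 1) := by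
  have key : ∀ m ≤ N, ‖ξ m - x m‖ ≤ m * h * B * Real.exp (Λ * (m * h)) * h ^ r →
      ‖ξ m - x m‖ ≤ T * B * Real.exp (Λ * T) * h ^ r ∧ ξ m ∈ ball (0 : E) (R + 1) := by
    intro m hm hb
    have hmT : m * h ≤ T :=
      (mul_le_mul_of_nonneg_right (by exact_mod_cast hm) hh).trans hT
    have h1 : ‖ξ m - x m‖ ≤ T * B * Real.exp (Λ * T) * h ^ r := by
      refine hb.trans ?_
      gcongr
      exact mul_nonneg ((mul_nonneg (Nat.cast_nonneg m) hh).trans hmT) hB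
    refine ⟨h1, ?_⟩
    rw [mem_ball_zero_iff]
    calc ‖ξ m‖ = ‖(ξ m - x m) + x m‖ := by simp
      _ ≤ ‖ξ m - x m‖ + ‖x m‖ := norm_add_le _ _
      _ < R + 1 := by linarith [hx m hm]
  have main : ∀ m ≤ N, ‖ξ m - x m‖ ≤ m * h * B * Real.exp (Λ * (m * h)) * h ^ r := by
    intro m
    induction m with
    | zero => intro _; simp [h0]
    | succ m ih =>
      intro hm
      have hb := ih (by omega)
      have hmem := (key m (by omega) hb).2
      have hxm : x m ∈ ball (0 : E) (R + 1) := by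
        rw [mem_ball_zero_iff]
        linarith [hx m (by omega)]
      have h1 := hlip _ hmem _ hxm
      have h2 := hloc m (by omega)
      rw [hξ m (by omega) hmem]
      have h3 : ‖Ψ (ξ m) - x (m + 1)‖ ≤ ‖Ψ (ξ m) - Ψ (x m)‖ + ‖Ψ (x m) - x (m + 1)‖ :=
        norm_sub_le_norm_sub_add_norm_sub _ _ _
      have hexp : 1 + Λ * h ≤ Real.exp (Λ * h) := by
        linarith [Real.add_one_le_exp (Λ * h)]
      have h4 : (1 + Λ * h) * ‖ξ m - x m‖
          ≤ Real.exp (Λ * h) * (m * h * B * Real.exp (Λ * (m * h)) * h ^ r) := by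
        gcongr
      have h5 : Real.exp (Λ * ((m + 1 : ℕ) * h))
          = Real.exp (Λ * h) * Real.exp (Λ * (m * h)) := by
        rw [← Real.exp_add]
        congr 1
        push_cast
        ring
      have h6 : 1 ≤ Real.exp (Λ * ((m + 1 : ℕ) * h)) := by
        rw [← Real.exp_zero]
        exact Real.exp_le_exp.2 (by positivity)
      have h7 : B * h ^ (r + 1) ≤ B * h ^ (r + 1) * Real.exp (Λ * ((m + 1 : ℕ) * h)) :=
        le_mul_of_one_le_right (by positivity) h6
      rw [h5] at h7 ⊢
      push_cast
      calc _ ≤ Real.exp (Λ * h) * (m * h * B * Real.exp (Λ * (m * h)) * h ^ r)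
            + B * h ^ (r + 1) * (Real.exp (Λ * h) * Real.exp (Λ * (m * h))) := by linarith
        _ = _ := by ring
  exact fun m hm => key m hm (main m hm)

/-! ### Convergence of Runge-Kutta methods for ordinary differential equations -/

section Convergence

variable {E : Type*} [NormedAddCommGroup E] [NormedSpace ℝ E] {s : ℕ}

/-- The order of a Runge-Kutta method transfers to differential equations on any finite-dimensional
normed space. -/
theorem RKHasOrder.local_error [FiniteDimensional ℝ E] {a : Matrix (Fin s) (Fin s) ℝ}
    {b : Fin s → ℝ} {r : ℕ} (hr : RKHasOrder a b r) {f : E → E} (hf : ContDiff ℝ ∞ f)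
    {y : ℝ → E} {ε : ℝ} (hε : 0 < ε) (hy : ∀ t ∈ Ioo (-ε) ε, HasDerivAt y (f (y t)) t) :
    ∃ B : ℝ, ∃ δ > 0, ∃ h₀ > 0, ∀ h : ℝ, 0 < h → h ≤ h₀ → ∀ Y : Fin s → E,
      Y = rkStages a f h (y 0) Y → (∀ i, ‖Y i - y 0‖ ≤ δ) →
      ‖rkEnd b f h (y 0) Y - y h‖ ≤ B * h ^ (r + 1) := by
  obtain ⟨e⟩ : Nonempty (E ≃L[ℝ] (Fin (Module.finrank ℝ E) → ℝ)) :=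
    ⟨ContinuousLinearEquiv.ofFinrankEq (by simp)⟩
  obtain ⟨B, δ, hδ, h₀, hh₀, H⟩ := hr _ (fun u => e (f (e.symm u)))
    (e.contDiff.comp (hf.comp e.symm.contDiff)) (fun t => e (y t)) ε hε (fun t ht => by
      simp only [ContinuousLinearEquiv.symm_apply_apply]
      exact e.hasFDerivAt.comp_hasDerivAt t (hy t ht))
  -- One is added because the norm of `e` is zero when `E` is trivial.
  have hN : 0 < ‖(e : E →L[ℝ] (Fin (Module.finrank ℝ E) → ℝ))‖ + 1 := by positivity
  refine ⟨‖(e.symm : (Fin (Module.finrank ℝ E) → ℝ) →L[ℝ] E)‖ * B,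
    δ / (‖(e : E →L[ℝ] (Fin (Module.finrank ℝ E) → ℝ))‖ + 1), by positivity, h₀, hh₀,
    fun h hh hle Y hY hYδ => ?_⟩
  have h1 := H h hh hle (fun i => e (Y i)) (fun i => by
    have := congrArg e (congrFun hY i)
    simpa [rkStages] using this) (fun i => by
    rw [← map_sub]
    refine ((e : E →L[ℝ] (Fin (Module.finrank ℝ E) → ℝ)).le_opNorm (Y i - y 0)).trans ?_
    have h2 := hYδ i
    rw [le_div_iff₀ hN] at h2
    nlinarith [norm_nonneg (Y i - y 0)])
  have h3 : e (rkEnd b f h (y 0) Y - y h)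
      = e (y 0) + h • ∑ j, b j • e (f (e.symm (e (Y j)))) - e (y h) := by
    simp [rkEnd]
  calc ‖rkEnd b f h (y 0) Y - y h‖ = ‖e.symm (e (rkEnd b f h (y 0) Y - y h))‖ := by simp
    _ ≤ ‖(e.symm : (Fin (Module.finrank ℝ E) → ℝ) →L[ℝ] E)‖ * ‖e (rkEnd b f h (y 0) Y - y h)‖ :=
      (e.symm : (Fin (Module.finrank ℝ E) → ℝ) →L[ℝ] E).le_opNorm _
    _ ≤ ‖(e.symm : (Fin (Module.finrank ℝ E) → ℝ) →L[ℝ] E)‖ * (B * h ^ (r + 1)) := by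
      rw [h3]
      gcongr
    _ = _ := by ring

/-- The local error of a method of order `r` is `O(h ^ (r + 1))` uniformly along a solution. -/
theorem RKHasOrder.exists_uniform_local_error [FiniteDimensional ℝ E]
    {a : Matrix (Fin s) (Fin s) ℝ} {b : Fin s → ℝ} {r : ℕ} (hr : RKHasOrder a b r) {f : E → E}
    (hf : ContDiff ℝ ∞ f) {R h₀ ρ t₀ t₁ : ℝ} (hh₀ : 0 < h₀) (hρ : 0 < ρ)
    {S : ℝ × E → (Fin s → E)} (hS : ContDiffOn ℝ ∞ S (Ioo (-h₀) h₀ ×ˢ ball 0 R))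
    (hSeq : ∀ h ∈ Ioo (-h₀) h₀, ∀ x ∈ ball (0 : E) R, S (h, x) = rkStages a f h x (S (h, x)))
    {x : ℝ → E} (hx : ∀ t ∈ Ioo (t₀ - 2 * ρ) (t₁ + 2 * ρ), HasDerivAt x (f (x t)) t)
    (hxR : ∀ t ∈ Ioo (t₀ - ρ) (t₁ + ρ), x t ∈ ball 0 R) :
    ∃ B ≥ 0, ∃ h₁ > 0, ∀ t ∈ Icc t₀ t₁, ∀ h, 0 < h → h ≤ h₁ →
      ‖rkEnd b f h (x t) (S (h, x t)) - x (t + h)‖ ≤ B * h ^ (r + 1) := by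
  -- With `|h| < η ≤ ρ`, the point `t + h` stays within the `2 * ρ` margin on which `x` is a
  -- solution.
  set η := min h₀ ρ with hη
  have hη0 : 0 < η := lt_min hh₀ hρ
  have hηh : η ≤ h₀ := min_le_left _ _
  have hηρ : η ≤ ρ := min_le_right _ _
  have hxs := contDiffOn_of_hasDerivAt_comp hf isOpen_Ioo hx
  have hx1 : ContDiffOn ℝ ∞ (fun p : ℝ × ℝ => x p.1)
      (Ioo (t₀ - ρ) (t₁ + ρ) ×ˢ Ioo (-η) η) :=
    hxs.comp contDiffOn_fst fun p hp => ⟨by linarith [hp.1.1], by linarith [hp.1.2]⟩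
  have hx2 : ContDiffOn ℝ ∞ (fun p : ℝ × ℝ => x (p.1 + p.2))
      (Ioo (t₀ - ρ) (t₁ + ρ) ×ˢ Ioo (-η) η) :=
    hxs.comp (contDiffOn_fst.add contDiffOn_snd) fun p hp =>
      ⟨by linarith [hp.1.1, hp.2.1], by linarith [hp.1.2, hp.2.2]⟩
  have hSx : ContDiffOn ℝ ∞ (fun p : ℝ × ℝ => S (p.2, x p.1))
      (Ioo (t₀ - ρ) (t₁ + ρ) ×ˢ Ioo (-η) η) :=
    hS.comp (contDiffOn_snd.prodMk hx1) fun p hp =>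
      ⟨⟨by linarith [hp.2.1], by linarith [hp.2.2]⟩, hxR _ hp.1⟩
  have hG : ContDiffOn ℝ ∞
      (fun p : ℝ × ℝ => rkEnd b f p.2 (x p.1) (S (p.2, x p.1)) - x (p.1 + p.2))
      (Ioo (t₀ - ρ) (t₁ + ρ) ×ˢ Ioo (-η) η) :=
    ((contDiff_rkEnd b hf).comp_contDiffOn ((contDiffOn_snd.prodMk hx1).prodMk hSx)).sub hx2
  obtain ⟨B, hB0, hB⟩ := exists_uniform_bound_of_pointwise (t₀ := t₀) (t₁ := t₁)
    (by linarith) (by linarith) hη0 (r + 1) hG (by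
      intro t ht
      have htR : x t ∈ ball 0 R := hxR t ⟨by linarith [ht.1], by linarith [ht.2]⟩
      obtain ⟨B, δ, hδ, ε, hε, H⟩ := hr.local_error hf (y := fun u => x (t + u)) hρ (by
        intro u hu
        have := hx (t + u) ⟨by linarith [ht.1, hu.1], by linarith [ht.2, hu.2]⟩
        exact this.comp_const_add t u)
      simp only [add_zero] at H
      have h0mem : (0 : ℝ) ∈ Ioo (-h₀) h₀ := ⟨by linarith, hh₀⟩
      have hS0 : ∀ i, S (0, x t) i = x t := fun i => by
        rw [hSeq 0 h0mem _ htR]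
        simp [rkStages]
      have hcont : ContinuousAt (fun h => S (h, x t)) 0 := by
        have h1 : ContinuousAt S (0, x t) := hS.continuousOn.continuousAt
          ((isOpen_Ioo.prod isOpen_ball).mem_nhds ⟨h0mem, htR⟩)
        exact ContinuousAt.comp (f := fun h : ℝ => (h, x t)) h1 (by fun_prop)
      -- The order condition covers only stages close to the initial value. The stages `S (h, x t)`
      -- qualify for small `h`, being continuous and equal to `x t` at `h = 0`.
      have hnear : ∀ᶠ h in 𝓝 (0 : ℝ), ∀ i, ‖S (h, x t) i - x t‖ < δ := by
        rw [eventually_all]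
        intro i
        have h1 : ContinuousAt (fun h => ‖S (h, x t) i - x t‖) 0 :=
          (((continuous_apply i).continuousAt.comp hcont).sub continuousAt_const).norm
        refine h1.eventually_lt continuousAt_const ?_
        simp [hS0, hδ]
      obtain ⟨ν, hν, hνS⟩ := Metric.eventually_nhds_iff.1 hnear
      refine ⟨B, min ε (min (ν / 2) (h₀ / 2)), by positivity, fun h hh hle => ?_⟩
      have hl1 : h ≤ ε := hle.trans (min_le_left _ _)
      have hl2 : h ≤ ν / 2 := hle.trans ((min_le_right _ _).trans (min_le_left _ _))
      have hl3 : h ≤ h₀ / 2 := hle.trans ((min_le_right _ _).trans (min_le_right _ _))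
      refine H h hh hl1 _ (hSeq h ⟨by linarith, by linarith⟩ _ htR) fun i => (hνS ?_ i).le
      rw [Real.dist_eq, sub_zero, abs_of_pos hh]
      linarith)
  exact ⟨B, hB0, η / 2, by positivity, fun t ht h hh hle => hB t ht h ⟨hh.le, hle⟩⟩

/-- A Runge-Kutta step for `y' = f y` with stages within `δ` of the initial value. -/
def RKStepNear (a : Matrix (Fin s) (Fin s) ℝ) (b : Fin s → ℝ) (f : E → E) (δ h : ℝ) (x : E)
    (X : Fin s → E) (x' : E) : Prop :=
  X = rkStages a f h x X ∧ (∀ i, ‖X i - x‖ ≤ δ) ∧ x' = rkEnd b f h x X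

/-- Convergence of a Runge-Kutta method of order `r` for a smooth differential equation. -/
theorem RKHasOrder.convergence [FiniteDimensional ℝ E] {a : Matrix (Fin s) (Fin s) ℝ}
    {b : Fin s → ℝ} {r : ℕ} (hr : RKHasOrder a b r) (hr1 : 1 ≤ r) {f : E → E}
    (hf : ContDiff ℝ ∞ f) {t₀ t₁ : ℝ} (ht : t₀ < t₁) {x : ℝ → E}
    (hx : ∀ t ∈ Icc t₀ t₁, HasDerivWithinAt x (f (x t)) (Icc t₀ t₁) t) {δ : ℝ} (hδ : 0 < δ) :
    ∃ B ≥ 0, ∃ h₀ > 0, ∀ h : ℝ, 0 < h → h ≤ h₀ → ∀ N : ℕ, N * h ≤ t₁ - t₀ →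
      (∃ ξ : ℕ → E, ξ 0 = x t₀ ∧ ∀ m < N, ∃ X, RKStepNear a b f δ h (ξ m) X (ξ (m + 1))) ∧
      ∀ ξ : ℕ → E, ξ 0 = x t₀ → (∀ m < N, ∃ X, RKStepNear a b f δ h (ξ m) X (ξ (m + 1))) →
        ∀ m ≤ N, ‖ξ m - x (t₀ + m * h)‖ ≤ B * h ^ r := by
  have : CompleteSpace E := FiniteDimensional.complete ℝ E
  obtain ⟨y, hyx, ε, hε, hy⟩ := exists_extension_of_hasDerivWithinAt hf ht hx
  set ρ := ε / 2 with hρ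
  have hρ0 : 0 < ρ := by positivity
  have hyc : ContinuousOn y (Icc (t₀ - ρ) (t₁ + ρ)) := fun t htI =>
    (hy t ⟨by linarith [htI.1], by linarith [htI.2]⟩).continuousAt.continuousWithinAt
  obtain ⟨R₀, hR₀⟩ := isCompact_Icc.exists_bound_of_continuousOn hyc
  set R := R₀ + 1 with hR
  obtain ⟨h₀, hh₀, S, Λ, hΛ, hSs, hSu, hSl⟩ := exists_rkSolution a b hf (R + 1) δ hδ
  obtain ⟨B, hB, h₁, hh₁, hloc⟩ := hr.exists_uniform_local_error hf hh₀ hρ0 hSs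
    (fun h hh x hx => ((hSu h hh x hx _).2 rfl).1) (t₀ := t₀) (t₁ := t₁) (x := y)
    (fun t htI => hy t ⟨by linarith [htI.1], by linarith [htI.2]⟩)
    (fun t htI => by
      rw [mem_ball_zero_iff]
      linarith [hR₀ t (Ioo_subset_Icc_self htI)])
  set C := (t₁ - t₀) * B * Real.exp (Λ * (t₁ - t₀)) with hC
  have hC0 : 0 ≤ C := mul_nonneg (mul_nonneg (by linarith) hB) (Real.exp_pos _).le
  -- The last two bounds give `C * h ^ r ≤ 1 / 2`, through `h ^ r ≤ h`, which uses `h ≤ 1` and `r ≥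
  -- 1`.
  refine ⟨C, hC0, min (min (h₀ / 2) h₁) (min 1 (1 / (2 * (C + 1)))), by positivity,
    fun h hh hle N hN => ?_⟩
  have hl1 : h ≤ h₀ / 2 := hle.trans ((min_le_left _ _).trans (min_le_left _ _))
  have hl2 : h ≤ h₁ := hle.trans ((min_le_left _ _).trans (min_le_right _ _))
  have hl3 : h ≤ 1 := hle.trans ((min_le_right _ _).trans (min_le_left _ _))
  have hl4 : h ≤ 1 / (2 * (C + 1)) := hle.trans ((min_le_right _ _).trans (min_le_right _ _))
  have hhI : h ∈ Ioo (-h₀) h₀ := ⟨by linarith, by linarith⟩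
  have hsmall : C * h ^ r ≤ 1 / 2 := by
    have h1 : h ^ r ≤ h := by simpa using pow_le_pow_of_le_one hh.le hl3 hr1
    rw [le_div_iff₀ (by positivity)] at hl4
    nlinarith
  have htm : ∀ m ≤ N, t₀ + m * h ∈ Icc t₀ t₁ := fun m hm => by
    have h1 : (m : ℝ) * h ≤ N * h :=
      mul_le_mul_of_nonneg_right (by exact_mod_cast hm) hh.le
    exact ⟨by have : 0 ≤ (m : ℝ) * h := by positivity
              linarith, by linarith⟩
  -- The recursion is required only while `ξ m` is in the ball, so the estimate serves both the
  -- sequence constructed by iterating `S` and an arbitrary numerical solution.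
  have hbound : ∀ ξ : ℕ → E, ξ 0 = x t₀ →
      (∀ m < N, ξ m ∈ ball (0 : E) (R + 1) → ξ (m + 1) = rkEnd b f h (ξ m) (S (h, ξ m))) →
      ∀ m ≤ N, ‖ξ m - y (t₀ + m * h)‖ ≤ C * h ^ r ∧ ξ m ∈ ball (0 : E) (R + 1) := by
    intro ξ hξ0 hξ
    refine global_error_bound (Ψ := fun u => rkEnd b f h u (S (h, u)))
      (x := fun m : ℕ => y (t₀ + m * h)) hh.le hB hΛ hN ?_ ?_ ?_ hsmall ?_ hξ
    · intro m hm
      have := htm m hm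
      have := hR₀ (t₀ + m * h) ⟨by linarith [this.1], by linarith [this.2]⟩
      linarith
    · intro u hu v hv
      have := hSl h hhI u hu v hv
      rwa [abs_of_pos hh] at this
    · intro m hm
      have := hloc _ (htm m hm.le) h hh hl2
      rw [show t₀ + ((m + 1 : ℕ) : ℝ) * h = t₀ + m * h + h by push_cast; ring]
      exact this
    · rw [hξ0]
      simp [hyx (left_mem_Icc.2 ht.le)]
  refine ⟨⟨fun m => Nat.rec (x t₀) (fun _ u => rkEnd b f h u (S (h, u))) m, rfl,
    fun m hm => ?_⟩, fun ξ hξ0 hξ m hm => ?_⟩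
  · have hm' := (hbound (fun m => Nat.rec (x t₀) (fun _ u => rkEnd b f h u (S (h, u))) m) rfl
      (fun _ _ _ => rfl) m hm.le).2
    have hsol := (hSu h hhI _ hm' _).2 rfl
    exact ⟨_, hsol.1, hsol.2, rfl⟩
  · rw [← hyx (htm m hm)]
    refine (hbound ξ hξ0 (fun m hm hmem => ?_) m hm).1
    obtain ⟨X, hX1, hX2, hX3⟩ := hξ m hm
    rw [hX3, (hSu h hhI _ hmem X).1 ⟨hX1, hX2⟩]

end Convergence

/-! ### Gradients and Fréchet derivatives -/

section Gradient

variable {ι : Type*} [Fintype ι] [DecidableEq ι]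

theorem fderiv_eq_grad_dotProduct (f : (ι → ℝ) → ℝ) (x u : ι → ℝ) :
    fderiv ℝ f x u = grad f x ⬝ᵥ u := by
  have hu : u = ∑ i, u i • (Pi.single i 1 : ι → ℝ) := by
    ext j
    simp [Finset.sum_apply, Pi.single_apply]
  conv_lhs => rw [hu, map_sum]
  refine Finset.sum_congr rfl fun i _ => ?_
  rw [map_smul, smul_eq_mul, mul_comm, grad]

theorem contDiff_grad {f : (ι → ℝ) → ℝ} (hf : ContDiff ℝ ∞ f) : ContDiff ℝ ∞ (grad f) :=
  contDiff_pi.2 fun _ => (hf.fderiv_right (m := ∞) (by simp)).clm_apply contDiff_const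

end Gradient

/-! ### Elimination of the multipliers for systems of index one -/

section Reduction

variable {n k : ℕ}

/-- The reduced phase space of points `(q, p)`. -/
abbrev ReducedPhase (n : ℕ) : Type := (Fin n → ℝ) × (Fin n → ℝ)

/-- The point of the extended phase space with given `(q, p)` and multipliers. -/
def phaseMk (x : ReducedPhase n) (l : Fin k → ℝ) : Phase n k := Sum.elim x.1 (Sum.elim x.2 l)

/-- The `(q, p)` components. -/
def phaseProj (z : Phase n k) : ReducedPhase n := (posn z, momn z)

@[simp] theorem posn_phaseMk (x : ReducedPhase n) (l : Fin k → ℝ) : posn (phaseMk x l) = x.1 := rfl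

@[simp] theorem momn_phaseMk (x : ReducedPhase n) (l : Fin k → ℝ) : momn (phaseMk x l) = x.2 := rfl

@[simp] theorem mult_phaseMk (x : ReducedPhase n) (l : Fin k → ℝ) : mult (phaseMk x l) = l := rfl

@[simp] theorem phaseProj_phaseMk (x : ReducedPhase n) (l : Fin k → ℝ) :
    phaseProj (phaseMk x l) = x := rfl

@[simp] theorem phaseMk_phaseProj (z : Phase n k) : phaseMk (phaseProj z) (mult z) = z := by
  ext (i | i | i) <;> rfl

theorem phase_ext {z w : Phase n k} (h : phaseProj z = phaseProj w) (h' : mult z = mult w) :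
    z = w := by
  rw [← phaseMk_phaseProj z, h, h', phaseMk_phaseProj]

theorem contDiff_phaseMk {m : ℕ∞ω} :
    ContDiff ℝ m (fun u : ReducedPhase n × (Fin k → ℝ) => phaseMk u.1 u.2) := by
  rw [contDiff_pi]
  rintro (i | i | i) <;> simp only [phaseMk, Sum.elim_inl, Sum.elim_inr] <;> fun_prop

/-- The projection to the `(q, p)` components as a continuous linear map. -/
def phaseProjL (n k : ℕ) : Phase n k →L[ℝ] ReducedPhase n :=
  (ContinuousLinearMap.pi fun i => ContinuousLinearMap.proj (Sum.inl i)).prod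
    (ContinuousLinearMap.pi fun i => ContinuousLinearMap.proj (Sum.inr (Sum.inl i)))

theorem contDiff_phaseProj {m : ℕ∞ω} : ContDiff ℝ m (phaseProj : Phase n k → ReducedPhase n) :=
  (phaseProjL n k).contDiff

theorem norm_phaseMk_le (x : ReducedPhase n) (l : Fin k → ℝ) : ‖phaseMk x l‖ ≤ ‖x‖ + ‖l‖ := by
  rw [pi_norm_le_iff_of_nonneg (by positivity)]
  rintro (i | i | i)
  · exact (norm_le_pi_norm x.1 i).trans ((norm_fst_le x).trans (by simp))
  · exact (norm_le_pi_norm x.2 i).trans ((norm_snd_le x).trans (by simp))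
  · exact (norm_le_pi_norm l i).trans (by simp)

/-- The embedding `(q, p) ↦ (-p, q, 0)`, through which multiplication by `J` factors. -/
def rotate (n k : ℕ) : ReducedPhase n →ₗ[ℝ] Phase n k where
  toFun x := phaseMk (-x.2, x.1) 0
  map_add' x y := by ext (i | i | i) <;> simp [phaseMk]; ring
  map_smul' c x := by ext (i | i | i) <;> simp [phaseMk]

theorem rotate_apply (x : ReducedPhase n) : rotate n k x = phaseMk (-x.2, x.1) 0 := rfl

theorem rotate_injective : Function.Injective (rotate n k) := by
  intro x y h
  have h1 := congrArg phaseProj h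
  simp only [rotate_apply, phaseProj_phaseMk, Prod.mk.injEq, neg_inj] at h1
  exact Prod.ext h1.2 h1.1

theorem norm_rotate (x : ReducedPhase n) : ‖rotate n k x‖ = ‖x‖ := by
  refine le_antisymm ?_ ?_
  · refine (norm_phaseMk_le _ _).trans ?_
    simp [Prod.norm_def, max_comm]
  · rw [Prod.norm_def, max_le_iff]
    constructor <;> rw [pi_norm_le_iff_of_nonneg (norm_nonneg _)] <;> intro i
    · exact norm_le_pi_norm (rotate n k x) (Sum.inr (Sum.inl i))
    · simpa [rotate, phaseMk] using norm_le_pi_norm (rotate n k x) (Sum.inl i)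

theorem structJ_mulVec (z : Phase n k) : structJ n k *ᵥ z = rotate n k (phaseProj z) := by
  ext (i | i | i) <;>
  simp [structJ, rotate, phaseMk, phaseProj, posn, momn, Matrix.mulVec, dotProduct,
    Matrix.one_apply]

theorem preForm_eq (u v : Phase n k) :
    preForm u v = (phaseProj u).2 ⬝ᵥ (phaseProj v).1 - (phaseProj u).1 ⬝ᵥ (phaseProj v).2 := by
  rw [preForm, structJ_mulVec, dotProduct]
  simp only [rotate_apply, phaseMk, phaseProj, Fintype.sum_sum_type, Sum.elim_inl, Sum.elim_inr,
    Pi.zero_apply, Pi.neg_apply, mul_zero, Finset.sum_const_zero, add_zero, mul_neg,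
    Finset.sum_neg_distrib, dotProduct, posn, momn]
  ring

/-- The canonical symplectic form on the reduced phase space. -/
noncomputable def reducedForm (n : ℕ) : ReducedPhase n →L[ℝ] ReducedPhase n →L[ℝ] ℝ :=
  ∑ i : Fin n,
    ((((ContinuousLinearMap.proj i).comp (ContinuousLinearMap.snd ℝ (Fin n → ℝ) (Fin n → ℝ))
      : ReducedPhase n →L[ℝ] ℝ)).smulRight
      (((ContinuousLinearMap.proj i).comp (ContinuousLinearMap.fst ℝ (Fin n → ℝ) (Fin n → ℝ))
        : ReducedPhase n →L[ℝ] ℝ)) -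
    (((ContinuousLinearMap.proj i).comp (ContinuousLinearMap.fst ℝ (Fin n → ℝ) (Fin n → ℝ))
      : ReducedPhase n →L[ℝ] ℝ)).smulRight
      (((ContinuousLinearMap.proj i).comp (ContinuousLinearMap.snd ℝ (Fin n → ℝ) (Fin n → ℝ))
        : ReducedPhase n →L[ℝ] ℝ)))

theorem reducedForm_apply (x y : ReducedPhase n) :
    reducedForm n x y = x.2 ⬝ᵥ y.1 - x.1 ⬝ᵥ y.2 := by
  simp [reducedForm, sum_apply, dotProduct]

theorem reducedForm_swap (x y : ReducedPhase n) : reducedForm n x y = - reducedForm n y x := by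
  rw [reducedForm_apply, reducedForm_apply, dotProduct_comm x.2, dotProduct_comm x.1]
  ring

/-- The Hamiltonian vector field obtained by eliminating the multipliers. -/
noncomputable def reducedField (H : Phase n k → ℝ) (lam : ReducedPhase n → (Fin k → ℝ))
    (x : ReducedPhase n) : ReducedPhase n :=
  (momn (grad H (phaseMk x (lam x))), - posn (grad H (phaseMk x (lam x))))

variable {H : Phase n k → ℝ} {lam : ReducedPhase n → (Fin k → ℝ)}

theorem contDiff_reducedField (hH : ContDiff ℝ ∞ H) (hlam : ContDiff ℝ ∞ lam) :
    ContDiff ℝ ∞ (reducedField H lam) := by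
  have h1 : ContDiff ℝ ∞ (fun x => grad H (phaseMk x (lam x))) :=
    (contDiff_grad hH).comp (contDiff_phaseMk.comp (contDiff_id.prodMk hlam))
  have h2 : ∀ j, ContDiff ℝ ∞ (fun x => grad H (phaseMk x (lam x)) j) := contDiff_pi.1 h1
  refine (contDiff_pi.2 fun i => ?_).prodMk (contDiff_pi.2 fun i => (h2 (Sum.inl i)).neg)
  exact h2 (Sum.inr (Sum.inl i))

/-- On the constraint set the multiplier block of the gradient vanishes, so the gradient lies in the
range of `J`; its `J`-preimage in `(q, p)` is the reduced field. -/
theorem grad_eq_rotate (hC : ∀ z : Phase n k, z ∈ constraintSet H ↔ mult z = lam (phaseProj z))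
    {z : Phase n k} (hz : z ∈ constraintSet H) :
    grad H z = rotate n k (reducedField H lam (phaseProj z)) := by
  refine phase_ext ?_ ?_
  · simp only [reducedField]
    rw [← (hC z).1 hz, phaseMk_phaseProj]
    simp [rotate_apply, phaseProj]
  · exact hz

theorem mult_structJ_mulVec (z : Phase n k) : mult (structJ n k *ᵥ z) = 0 := by
  rw [structJ_mulVec]
  rfl

/-- Since `J F` has no multiplier block, the slope equations already force the stages into the
constraint set. What remains lies in the image of the injective map `rotate`, which can be
cancelled. -/
theorem rkStep_iff {s : ℕ} {a : Matrix (Fin s) (Fin s) ℝ} {b : Fin s → ℝ}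
    (hC : ∀ z : Phase n k, z ∈ constraintSet H ↔ mult z = lam (phaseProj z)) {h : ℝ}
    {z₀ : Phase n k} {Z : Fin s → Phase n k} {z₁ : Phase n k} :
    RKStep a b H h z₀ Z z₁ ↔ (∀ j, Z j ∈ constraintSet H) ∧
      (fun j => phaseProj (Z j))
        = rkStages a (reducedField H lam) h (phaseProj z₀) (fun j => phaseProj (Z j)) ∧
      phaseProj z₁
        = rkEnd b (reducedField H lam) h (phaseProj z₀) (fun j => phaseProj (Z j)) := by
  have hsum : ∀ (z : Phase n k) (c : Fin s → ℝ),
      (structJ n k *ᵥ z = structJ n k *ᵥ z₀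
        + h • ∑ j, c j • rotate n k (reducedField H lam (phaseProj (Z j)))) ↔
      phaseProj z = phaseProj z₀ + h • ∑ j, c j • reducedField H lam (phaseProj (Z j)) := by
    intro z c
    rw [structJ_mulVec, structJ_mulVec, ← (rotate_injective (k := k)).eq_iff (a := phaseProj z)]
    simp only [map_add, map_smul, map_sum]
  constructor
  · rintro ⟨F, h1, h2, h3⟩
    have hZ : ∀ j, Z j ∈ constraintSet H := fun j => by
      rw [constraintSet, mem_ofPred_eq, ← h3 j, mult_structJ_mulVec]
    have h4 : ∀ j, structJ n k *ᵥ F j = rotate n k (reducedField H lam (phaseProj (Z j))) :=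
      fun j => (h3 j).trans (grad_eq_rotate hC (hZ j))
    simp only [h4] at h1 h2
    exact ⟨hZ, funext fun i => (hsum _ _).1 (h1 i), (hsum _ _).1 h2⟩
  · rintro ⟨hZ, h1, h2⟩
    -- The equations do not see the multiplier part of the slopes; zero is an arbitrary choice.
    refine ⟨fun j => phaseMk (reducedField H lam (phaseProj (Z j))) 0, ?_, ?_, ?_⟩
    · intro i
      simp only [structJ_mulVec (phaseMk _ _), phaseProj_phaseMk]
      exact (hsum _ _).2 (congrFun h1 i)
    · simp only [structJ_mulVec (phaseMk _ _), phaseProj_phaseMk]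
      exact (hsum _ _).2 h2
    · intro j
      rw [structJ_mulVec, phaseProj_phaseMk]
      exact (grad_eq_rotate hC (hZ j)).symm

theorem integratorStep_iff {s : ℕ} {a : Matrix (Fin s) (Fin s) ℝ} {b : Fin s → ℝ}
    (hC : ∀ z : Phase n k, z ∈ constraintSet H ↔ mult z = lam (phaseProj z)) {δ h : ℝ}
    {z₀ : Phase n k} {Z : Fin s → Phase n k} {z₁ : Phase n k} :
    IntegratorStep a b H δ h z₀ Z z₁ ↔
      RKStepNear a b (reducedField H lam) δ h (phaseProj z₀) (fun j => phaseProj (Z j))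
        (phaseProj z₁) ∧
      (∀ j, mult (Z j) = lam (phaseProj (Z j))) ∧ mult z₁ = lam (phaseProj z₁) := by
  have hn : ∀ i, ‖structJ n k *ᵥ Z i - structJ n k *ᵥ z₀‖ = ‖phaseProj (Z i) - phaseProj z₀‖ :=
    fun i => by rw [structJ_mulVec, structJ_mulVec, ← map_sub, norm_rotate]
  simp only [IntegratorStep, RKStepNear, rkStep_iff hC, hn, hC]
  tauto

/-- The variation of `lam` contributes only through `∂H/∂l`, which is zero on the graph; hence the
reduced field is the Hamiltonian vector field of the restriction of `H`. -/
theorem fderiv_reducedHamiltonian (hH : ContDiff ℝ ∞ H) (hlam : ContDiff ℝ ∞ lam)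
    (hC : ∀ z : Phase n k, z ∈ constraintSet H ↔ mult z = lam (phaseProj z))
    (x u : ReducedPhase n) :
    fderiv ℝ (fun x => H (phaseMk x (lam x))) x u
      = - reducedForm n (reducedField H lam x) u := by
  set L : ReducedPhase n × (Fin k → ℝ) →ₗ[ℝ] Phase n k :=
    { toFun := fun u => phaseMk u.1 u.2
      map_add' := fun x y => by ext (i | i | i) <;> simp [phaseMk]
      map_smul' := fun c x => by ext (i | i | i) <;> simp [phaseMk] } with hL
  have h1 : HasFDerivAt (fun x => phaseMk x (lam x))
      ((LinearMap.toContinuousLinearMap L).comp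
        ((ContinuousLinearMap.id ℝ _).prod (fderiv ℝ lam x))) x :=
    (LinearMap.toContinuousLinearMap L).hasFDerivAt.comp x
      ((hasFDerivAt_id x).prodMk (hlam.differentiable (by simp)).differentiableAt.hasFDerivAt)
  have h2 := ((hH.differentiable (by simp)).differentiableAt
    (x := phaseMk x (lam x))).hasFDerivAt.comp x h1
  have h3 : fderiv ℝ (fun x => H (phaseMk x (lam x))) x u
      = fderiv ℝ H (phaseMk x (lam x)) (phaseMk u (fderiv ℝ lam x u)) := by
    rw [show (fun x => H (phaseMk x (lam x))) = H ∘ fun x => phaseMk x (lam x) from rfl, h2.fderiv]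
    rfl
  have h4 : ∀ i, grad H (phaseMk x (lam x)) (Sum.inr (Sum.inr i)) = 0 := by
    have : phaseMk x (lam x) ∈ constraintSet H := by rw [hC]; rfl
    exact fun i => congrFun this i
  rw [h3, fderiv_eq_grad_dotProduct, reducedForm_apply]
  simp only [reducedField]
  generalize grad H (phaseMk x (lam x)) = g at h4 ⊢
  simp only [dotProduct, Fintype.sum_sum_type, h4, zero_mul, Finset.sum_const_zero, add_zero,
    phaseMk, Sum.elim_inl, Sum.elim_inr, posn, momn, Pi.neg_apply, neg_mul,
    Finset.sum_neg_distrib]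
  ring

/-- The reduced field is infinitesimally symplectic: the identity is the symmetry of the second
derivative of the reduced Hamiltonian. -/
theorem reducedForm_fderiv_reducedField (hH : ContDiff ℝ ∞ H) (hlam : ContDiff ℝ ∞ lam)
    (hC : ∀ z : Phase n k, z ∈ constraintSet H ↔ mult z = lam (phaseProj z))
    (x u v : ReducedPhase n) :
    reducedForm n (fderiv ℝ (reducedField H lam) x u) v
      + reducedForm n u (fderiv ℝ (reducedField H lam) x v) = 0 := by
  set G : ReducedPhase n → ℝ := fun x => H (phaseMk x (lam x)) with hG
  have hGs : ContDiff ℝ ∞ G := hH.comp (contDiff_phaseMk.comp (contDiff_id.prodMk hlam))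
  have hfd : fderiv ℝ G = fun x => - reducedForm n (reducedField H lam x) := by
    ext1 x
    refine ContinuousLinearMap.ext fun u => ?_
    simpa using fderiv_reducedHamiltonian hH hlam hC x u
  have h2 : ∀ u v, fderiv ℝ (fderiv ℝ G) x u v
      = - reducedForm n (fderiv ℝ (reducedField H lam) x u) v := by
    intro u v
    have h3 : HasFDerivAt (fun x => - reducedForm n (reducedField H lam x))
        (-((reducedForm n).comp (fderiv ℝ (reducedField H lam) x))) x :=
      ((reducedForm n).hasFDerivAt.comp x ((contDiff_reducedField hH hlam).differentiable
        (by simp)).differentiableAt.hasFDerivAt).neg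
    rw [hfd, h3.fderiv]
    simp
  have hsymm : IsSymmSndFDerivAt ℝ G x :=
    hGs.contDiffAt.isSymmSndFDerivAt
      (by simpa using WithTop.coe_le_coe.2 (le_top : (2 : ℕ∞) ≤ ⊤))
  have h5 := hsymm u v
  rw [h2, h2] at h5
  rw [reducedForm_swap u]
  linarith

/-- A Runge-Kutta method applied to a generalized Hamiltonian system of index one is well defined,
and symplectic if the method is. -/
theorem IsSymplecticRK.isWellDefinedSymplectic {s : ℕ} {a : Matrix (Fin s) (Fin s) ℝ}
    {b : Fin s → ℝ} (hab : IsSymplecticRK a b) (hH : ContDiff ℝ ∞ H) (hind : IndexOne H) :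
    IsWellDefinedSymplectic a b H := by
  obtain ⟨lam, hlam, hC⟩ := hind
  replace hC : ∀ z : Phase n k, z ∈ constraintSet H ↔ mult z = lam (phaseProj z) := hC
  intro K hK δ hδ
  have hf := contDiff_reducedField hH hlam
  obtain ⟨R, hR⟩ := hK.exists_bound_of_continuousOn
    (f := (phaseProj : Phase n k → ReducedPhase n))
    (contDiff_phaseProj (m := 0)).continuous.continuousOn
  obtain ⟨h₀, hh₀, S, Λ, -, hSs, hSu, -⟩ := exists_rkSolution a b hf (R + 1) δ hδ
  -- Only `(q, p)` is restricted in the neighbourhood, because the equations ignore the multipliers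
  -- of the initial point.
  have hUo : IsOpen ((phaseProj : Phase n k → ReducedPhase n) ⁻¹' ball 0 (R + 1)) :=
    isOpen_ball.preimage (contDiff_phaseProj (m := 0)).continuous
  refine ⟨h₀, hh₀, _, hUo, fun z hz => ?_, fun h hh => ?_⟩
  · rw [mem_preimage, mem_ball_zero_iff]
    linarith [hR z hz]
  have hhI : h ∈ Ioo (-h₀) h₀ := abs_lt.1 hh
  have hSh : ContDiffOn ℝ ∞ (fun x => S (h, x)) (ball 0 (R + 1)) :=
    hSs.comp (contDiffOn_const.prodMk contDiffOn_id) fun x hx => ⟨hhI, hx⟩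
  set Ψ : ReducedPhase n → ReducedPhase n :=
    fun x => rkEnd b (reducedField H lam) h x (S (h, x)) with hΨ
  have hΨs : ContDiffOn ℝ ∞ Ψ (ball 0 (R + 1)) :=
    (contDiff_rkEnd b hf).comp_contDiffOn
      ((contDiffOn_const.prodMk contDiffOn_id).prodMk hSh)
  have hlift : ContDiff ℝ ∞ (fun x => phaseMk x (lam x)) :=
    contDiff_phaseMk.comp (contDiff_id.prodMk hlam)
  have hΦs : ContDiffOn ℝ ∞
      (fun z : Phase n k => phaseMk (Ψ (phaseProj z)) (lam (Ψ (phaseProj z))))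
      (phaseProj ⁻¹' ball 0 (R + 1)) :=
    hlift.comp_contDiffOn (hΨs.comp contDiff_phaseProj.contDiffOn fun z hz => hz)
  refine ⟨fun z => phaseMk (Ψ (phaseProj z)) (lam (Ψ (phaseProj z))),
    fun i z => phaseMk (S (h, phaseProj z) i) (lam (S (h, phaseProj z) i)), hΦs, fun i => ?_,
    fun z₀ hz₀ Z z₁ => ?_, fun z₀ _ => (hC _).2 rfl, fun z₀ hz₀ u v => ?_⟩
  · have h1 : ContDiffOn ℝ ∞ (fun x => S (h, x) i) (ball 0 (R + 1)) := contDiffOn_pi.1 hSh i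
    exact hlift.comp_contDiffOn (h1.comp contDiff_phaseProj.contDiffOn fun z hz => hz)
  · rw [integratorStep_iff hC, RKStepNear]
    have hZ := hSu h hhI _ hz₀ (fun j => phaseProj (Z j))
    constructor
    · rintro ⟨⟨hA, hB, h2⟩, h3, h4⟩
      have h1 := hZ.1 ⟨hA, hB⟩
      have h5 : ∀ i, phaseProj (Z i) = S (h, phaseProj z₀) i := fun i => congrFun h1 i
      rw [h1] at h2
      refine ⟨fun i => phase_ext (h5 i) ?_, phase_ext h2 ?_⟩
      · rw [h3, h5, mult_phaseMk]
      · rw [h4, h2, mult_phaseMk]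
    · rintro ⟨h1, rfl⟩
      have h5 : (fun j => phaseProj (Z j)) = S (h, phaseProj z₀) := by
        ext1 j
        rw [h1, phaseProj_phaseMk]
      obtain ⟨hA, hB⟩ := hZ.2 h5
      refine ⟨⟨hA, hB, ?_⟩, fun j => by rw [h1]; rfl, rfl⟩
      rw [h5]
      rfl
  · have hΨd : HasFDerivAt Ψ (fderiv ℝ Ψ (phaseProj z₀)) (phaseProj z₀) :=
      ((hΨs.contDiffAt (isOpen_ball.mem_nhds hz₀)).differentiableAt (by simp)).hasFDerivAt
    have hΦd := ((hΦs.contDiffAt (hUo.mem_nhds hz₀)).differentiableAt (by simp)).hasFDerivAt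
    -- The projection intertwines the full step with the reduced step, so the 2-form need only be
    -- checked downstairs.
    have hp : ∀ w, phaseProj (fderiv ℝ
        (fun z : Phase n k => phaseMk (Ψ (phaseProj z)) (lam (Ψ (phaseProj z)))) z₀ w)
        = fderiv ℝ Ψ (phaseProj z₀) (phaseProj w) := by
      intro w
      have h1 := (phaseProjL n k).hasFDerivAt.comp z₀ hΦd
      have h2 : HasFDerivAt (fun z : Phase n k => Ψ (phaseProj z))
          ((fderiv ℝ Ψ (phaseProj z₀)).comp (phaseProjL n k)) z₀ :=
        HasFDerivAt.comp (f := phaseProj) z₀ hΨd (phaseProjL n k).hasFDerivAt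
      exact congrArg (fun T : Phase n k →L[ℝ] ReducedPhase n => T w) (h1.unique h2)
    rw [preForm_eq, preForm_eq, hp, hp, ← reducedForm_apply, ← reducedForm_apply]
    refine hab.fderiv_rkEnd_invariant (reducedForm n) hf
      (reducedForm_fderiv_reducedField hH hlam hC) h
      ((hSh.contDiffAt (isOpen_ball.mem_nhds hz₀)).differentiableAt (by simp)) ?_ _ _
    filter_upwards [isOpen_ball.mem_nhds hz₀] with y hy
    exact ((hSu h hhI y hy _).2 rfl).1

/-- A Runge-Kutta method of order `r` applied to a generalized Hamiltonian system of index one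
converges with order `r`. -/
theorem RKHasOrder.isConvergentOfOrder {s r : ℕ} {a : Matrix (Fin s) (Fin s) ℝ} {b : Fin s → ℝ}
    (hr : RKHasOrder a b r) (hr1 : 1 ≤ r) (hH : ContDiff ℝ ∞ H) (hind : IndexOne H) :
    IsConvergentOfOrder a b H r := by
  obtain ⟨lam, hlam, hC⟩ := hind
  replace hC : ∀ z : Phase n k, z ∈ constraintSet H ↔ mult z = lam (phaseProj z) := hC
  intro t₀ t₁ ht z hz δ hδ
  have hzC : ∀ t ∈ Icc t₀ t₁, z t ∈ constraintSet H := fun t htI => by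
    obtain ⟨z', -, h2⟩ := hz t htI
    rw [constraintSet, mem_ofPred_eq, ← h2, mult_structJ_mulVec]
  have hx : ∀ t ∈ Icc t₀ t₁, HasDerivWithinAt (fun t => phaseProj (z t))
      (reducedField H lam (phaseProj (z t))) (Icc t₀ t₁) t := fun t htI => by
    obtain ⟨z', h1, h2⟩ := hz t htI
    rw [grad_eq_rotate hC (hzC t htI), structJ_mulVec, rotate_injective.eq_iff] at h2
    rw [← h2]
    exact (phaseProjL n k).hasFDerivAt.comp_hasDerivWithinAt t h1
  obtain ⟨B, hB, h₀, hh₀, hconv⟩ := hr.convergence hr1 (contDiff_reducedField hH hlam) ht hx hδ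
  obtain ⟨R, hR⟩ := isCompact_Icc.exists_bound_of_continuousOn
    (fun t htI => (hx t htI).continuousWithinAt)
  -- The radius leaves room for the numerical solution, whose `(q, p)` error `B * h ^ r` is kept
  -- below 1 by the choice of step bound.
  obtain ⟨Λ, hΛ⟩ := (hlam.contDiffOn (s := closedBall 0 (R + 1))).exists_lipschitzOnWith (by simp)
    (convex_closedBall _ _) (isCompact_closedBall _ _)
  refine ⟨B + Λ * B, min h₀ (min 1 (1 / (B + 1))), by positivity, fun h hh hle N hN => ?_⟩
  have hl1 : h ≤ h₀ := hle.trans (min_le_left _ _)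
  have hl2 : h ≤ 1 := hle.trans ((min_le_right _ _).trans (min_le_left _ _))
  have hl3 : h ≤ 1 / (B + 1) := hle.trans ((min_le_right _ _).trans (min_le_right _ _))
  obtain ⟨⟨ξ, hξ0, hξ⟩, hall⟩ := hconv h hh hl1 N hN
  have ht0 : t₀ ∈ Icc t₀ t₁ := left_mem_Icc.2 ht.le
  constructor
  · refine ⟨fun m => phaseMk (ξ m) (lam (ξ m)), ?_, fun m hm => ?_⟩
    · refine phase_ext hξ0 ?_
      rw [mult_phaseMk, hξ0, (hC _).1 (hzC _ ht0)]
    · obtain ⟨X, hX⟩ := hξ m hm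
      exact ⟨fun j => phaseMk (X j) (lam (X j)),
        (integratorStep_iff hC).2 ⟨hX, fun _ => rfl, rfl⟩⟩
  · rintro ζ ⟨hζ0, hζ⟩ m hm
    have hζC : mult (ζ m) = lam (phaseProj (ζ m)) := by
      -- The initial point is on the constraint set because the exact solution is; later points are
      -- there by definition of the step.
      cases m with
      | zero => rw [hζ0, (hC _).1 (hzC _ ht0)]
      | succ m =>
        obtain ⟨Z, hZ⟩ := hζ m hm
        exact (hC _).1 hZ.2.2
    have hmT : t₀ + m * h ∈ Icc t₀ t₁ := by
      have h1 : (m : ℝ) * h ≤ N * h :=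
        mul_le_mul_of_nonneg_right (by exact_mod_cast hm) hh.le
      have h2 : 0 ≤ (m : ℝ) * h := by positivity
      exact ⟨by linarith, by linarith⟩
    have h1 := hall (fun m => phaseProj (ζ m)) (by rw [hζ0]) (fun m hm => by
      obtain ⟨Z, hZ⟩ := hζ m hm
      exact ⟨_, ((integratorStep_iff hC).1 hZ).1⟩) m hm
    have hsmall : B * h ^ r ≤ 1 := by
      have h2 : h ^ r ≤ h := by simpa using pow_le_pow_of_le_one hh.le hl2 hr1
      rw [le_div_iff₀ (by positivity)] at hl3
      nlinarith
    have h3 := hR _ hmT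
    have h4 : phaseProj (ζ m) ∈ closedBall (0 : ReducedPhase n) (R + 1) := by
      rw [mem_closedBall_zero_iff]
      calc ‖phaseProj (ζ m)‖
          = ‖(phaseProj (ζ m) - phaseProj (z (t₀ + m * h))) + phaseProj (z (t₀ + m * h))‖ := by simp
        _ ≤ _ := norm_add_le _ _
        _ ≤ R + 1 := by linarith
    have h5 : phaseProj (z (t₀ + m * h)) ∈ closedBall (0 : ReducedPhase n) (R + 1) := by
      rw [mem_closedBall_zero_iff]
      linarith
    have h6 := hΛ.dist_le_mul _ h4 _ h5
    rw [dist_eq_norm, dist_eq_norm] at h6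
    have h7 : ζ m - z (t₀ + m * h) = phaseMk (phaseProj (ζ m) - phaseProj (z (t₀ + m * h)))
        (lam (phaseProj (ζ m)) - lam (phaseProj (z (t₀ + m * h)))) := by
      refine phase_ext rfl ?_
      rw [mult_phaseMk, ← hζC, ← (hC _).1 (hzC _ hmT)]
      rfl
    rw [h7]
    refine (norm_phaseMk_le _ _).trans ?_
    have h8 := mul_le_mul_of_nonneg_left h1 Λ.2
    change (Λ : ℝ) * _ ≤ Λ * _ at h8
    linarith

/-- If the constraint functions, evaluated at the recovered velocity, are the components of
`∂H/∂l`, then a symplectic Runge-Kutta method for a system of index one is well defined,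
symplectic, convergent with its order, and satisfies the constraints exactly. -/
theorem IndexOne.rungeKutta_properties {s : ℕ} {a : Matrix (Fin s) (Fin s) ℝ} {b : Fin s → ℝ}
    (hind : IndexOne H) (hH : ContDiff ℝ ∞ H) (hab : IsSymplecticRK a b)
    {c : Fin k → (Fin n → ℝ) → (Fin n → ℝ) → ℝ} {vel : Phase n k → (Fin n → ℝ)}
    (hc : ∀ z i, mult (grad H z) i = c i (posn z) (vel z)) :
    IndexOne H ∧ IsWellDefinedSymplectic a b H ∧
      (∀ r : ℕ, 1 ≤ r → RKHasOrder a b r → IsConvergentOfOrder a b H r) ∧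
      ConstraintsExact a b H c vel := by
  refine ⟨hind, hab.isWellDefinedSymplectic hH hind,
    fun r hr1 hr => hr.isConvergentOfOrder hr1 hH hind, fun h N ζ Z hstep => ⟨?_, ?_⟩⟩
  · intro m hm j i
    obtain ⟨F, -, -, hF⟩ := hstep m hm
    rw [← hc, ← hF, mult_structJ_mulVec]
    rfl
  · intro hζ m hm i
    rw [← hc]
    exact congrFun (hζ m hm) i

/-- A system has index one if the equation `∂H/∂l = 0` is uniquely solvable for the multipliers
and its derivative with respect to them is injective at the solutions. -/
theorem indexOne_of_existsUnique (hH : ContDiff ℝ ∞ H)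
    (hex : ∀ x : ReducedPhase n, ∃! l : Fin k → ℝ, phaseMk x l ∈ constraintSet H)
    (hinj : ∀ (x : ReducedPhase n) (l : Fin k → ℝ), phaseMk x l ∈ constraintSet H → ∀ v,
      fderiv ℝ (fun l => mult (grad H (phaseMk x l))) l v = 0 → v = 0) : IndexOne H := by
  choose lam hlam hun using hex
  have hP : ContDiff ℝ ∞ (fun u : ReducedPhase n × (Fin k → ℝ) =>
      mult (grad H (phaseMk u.1 u.2))) :=
    contDiff_pi.2 fun i => contDiff_pi.1 ((contDiff_grad hH).comp contDiff_phaseMk) _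
  refine ⟨lam, contDiff_iff_contDiffAt.2 fun x => ?_, fun z => ⟨fun hz => ?_, fun hz => ?_⟩⟩
  · obtain ⟨φ, hφ, -, hφP⟩ := exists_contDiffAt_implicit (x₀ := x) (w₀ := lam x)
      hP.contDiffAt (hinj x (lam x) (hlam x))
    refine hφ.congr_of_eventuallyEq ?_
    filter_upwards [hφP] with y hy
    exact (hun y (φ y) (hy.trans (hlam x))).symm
  · refine hun (phaseProj z) (mult z) ?_
    change phaseMk (phaseProj z) (mult z) ∈ constraintSet H
    rwa [phaseMk_phaseProj]
  · have h1 := hlam (phaseProj z)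
    rwa [show lam (phaseProj z) = mult z from hz.symm, phaseMk_phaseProj] at h1

end Reduction

/-! ### Partial derivatives with respect to the multipliers -/

section MultiplierGradient

variable {n k : ℕ} {H : Phase n k → ℝ}

theorem phaseMk_add_smul_single (x : ReducedPhase n) (l : Fin k → ℝ) (t : ℝ) (i : Fin k) :
    phaseMk x (l + t • Pi.single i 1)
      = phaseMk x l + t • (Pi.single (Sum.inr (Sum.inr i)) 1 : Phase n k) := by
  ext (j | j | j) <;> simp [phaseMk, Pi.single_apply]

theorem hasDerivAt_multiplier_line (hH : ContDiff ℝ ∞ H) (x : ReducedPhase n) (l : Fin k → ℝ)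
    (i : Fin k) : HasDerivAt (fun t : ℝ => H (phaseMk x (l + t • Pi.single i 1)))
      (mult (grad H (phaseMk x l)) i) 0 := by
  have h1 : HasLineDerivAt ℝ H (fderiv ℝ H (phaseMk x l) (Pi.single (Sum.inr (Sum.inr i)) 1))
      (phaseMk x l) (Pi.single (Sum.inr (Sum.inr i)) 1) :=
    (hH.differentiable (by simp)).differentiableAt.hasFDerivAt.hasLineDerivAt _
  unfold HasLineDerivAt at h1
  simp only [phaseMk_add_smul_single]
  exact h1

end MultiplierGradient

/-! ### Mechanical Hamiltonians with constraints linear in the velocity -/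

section Mechanical

variable {n k : ℕ}

theorem contDiff_posn {m : ℕ∞ω} : ContDiff ℝ m (posn : Phase n k → Fin n → ℝ) :=
  contDiff_fst.comp contDiff_phaseProj

theorem contDiff_momn {m : ℕ∞ω} : ContDiff ℝ m (momn : Phase n k → Fin n → ℝ) :=
  contDiff_snd.comp contDiff_phaseProj

theorem contDiff_mult {m : ℕ∞ω} : ContDiff ℝ m (mult : Phase n k → Fin k → ℝ) := by
  unfold mult
  fun_prop

theorem ContDiff.dotProduct {ι E : Type*} [Fintype ι] [NormedAddCommGroup E] [NormedSpace ℝ E]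
    {m : ℕ∞ω} {u v : E → (ι → ℝ)} (hu : ContDiff ℝ m u) (hv : ContDiff ℝ m v) :
    ContDiff ℝ m (fun x => u x ⬝ᵥ v x) :=
  ContDiff.sum fun i _ => (contDiff_pi.1 hu i).mul (contDiff_pi.1 hv i)

theorem ContDiff.mulVec {ι κ E : Type*} [Fintype ι] [Fintype κ] [NormedAddCommGroup E]
    [NormedSpace ℝ E] {m : ℕ∞ω} (A : Matrix κ ι ℝ) {v : E → (ι → ℝ)} (hv : ContDiff ℝ m v) :
    ContDiff ℝ m (fun x => A *ᵥ v x) :=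
  contDiff_pi.2 fun _ => contDiff_const.dotProduct hv

variable {M : Matrix (Fin n) (Fin n) ℝ} {V : (Fin n → ℝ) → ℝ}
  {g : Fin k → (Fin n → ℝ) → (Fin n → ℝ)}

theorem contDiff_shiftedMomentum (hg : ∀ i, ContDiff ℝ ∞ (g i)) :
    ContDiff ℝ ∞ (shiftedMomentum g) :=
  contDiff_momn.add (ContDiff.sum fun i _ =>
    (contDiff_pi.1 contDiff_mult i).smul ((hg i).comp contDiff_posn))

theorem contDiff_mechHamiltonian (M : Matrix (Fin n) (Fin n) ℝ) (hV : ContDiff ℝ ∞ V)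
    (hg : ∀ i, ContDiff ℝ ∞ (g i)) : ContDiff ℝ ∞ (mechHamiltonian M V g) :=
  (contDiff_const.mul ((contDiff_shiftedMomentum hg).dotProduct
    ((contDiff_shiftedMomentum hg).mulVec M⁻¹))).add (hV.comp contDiff_posn)

theorem shiftedMomentum_phaseMk (x : ReducedPhase n) (l : Fin k → ℝ) :
    shiftedMomentum g (phaseMk x l) = x.2 + (Matrix.of fun i => g i x.1)ᵀ *ᵥ l := by
  ext j
  simp [shiftedMomentum, Matrix.mulVec, dotProduct, mul_comm]

/-- Along a multiplier axis the Hamiltonian is a quadratic polynomial; symmetry of `M` merges the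
two cross terms into its linear coefficient, which is the constraint. -/
theorem mult_grad_mechHamiltonian (hM : M.IsSymm) (hV : ContDiff ℝ ∞ V)
    (hg : ∀ i, ContDiff ℝ ∞ (g i)) (z : Phase n k) (i : Fin k) :
    mult (grad (mechHamiltonian M V g) z) i = g i (posn z) ⬝ᵥ mechVelocity M g z := by
  have h1 := hasDerivAt_multiplier_line (contDiff_mechHamiltonian M hV hg) (phaseProj z) (mult z) i
  rw [phaseMk_phaseProj] at h1
  refine h1.unique ?_
  set σ := shiftedMomentum g z with hσ
  set γ := g i (posn z) with hγ
  have hs : ∀ t : ℝ, shiftedMomentum g (phaseMk (phaseProj z) (mult z + t • Pi.single i 1))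
      = σ + t • γ := by
    intro t
    rw [hσ, ← phaseMk_phaseProj z, shiftedMomentum_phaseMk, shiftedMomentum_phaseMk,
      phaseMk_phaseProj, Matrix.mulVec_add, Matrix.mulVec_smul, add_assoc]
    congr 3
    ext j
    simp [hγ, phaseProj]
  have hsymm : σ ⬝ᵥ (M⁻¹ *ᵥ γ) = γ ⬝ᵥ (M⁻¹ *ᵥ σ) := by
    rw [Matrix.dotProduct_mulVec, ← Matrix.mulVec_transpose, Matrix.transpose_nonsing_inv, hM.eq,
      dotProduct_comm]
  have hH : ∀ t : ℝ, mechHamiltonian M V g (phaseMk (phaseProj z) (mult z + t • Pi.single i 1))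
      = (1 / 2 * (σ ⬝ᵥ (M⁻¹ *ᵥ σ)) + V (posn z)) + t * (γ ⬝ᵥ (M⁻¹ *ᵥ σ))
        + t ^ 2 * (1 / 2 * (γ ⬝ᵥ (M⁻¹ *ᵥ γ))) := by
    intro t
    rw [mechHamiltonian, hs]
    simp only [Matrix.mulVec_add, Matrix.mulVec_smul, add_dotProduct, dotProduct_add,
      smul_dotProduct, dotProduct_smul, smul_eq_mul, hsymm, posn_phaseMk]
    simp only [phaseProj]
    ring
  simp only [hH]
  have h2 : HasDerivAt (fun t : ℝ => (1 / 2 * (σ ⬝ᵥ (M⁻¹ *ᵥ σ)) + V (posn z))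
      + t * (γ ⬝ᵥ (M⁻¹ *ᵥ σ)) + t ^ 2 * (1 / 2 * (γ ⬝ᵥ (M⁻¹ *ᵥ γ))))
      (1 * (γ ⬝ᵥ (M⁻¹ *ᵥ σ))
        + ((2 : ℕ) * (0 : ℝ) ^ (2 - 1) * 1) * (1 / 2 * (γ ⬝ᵥ (M⁻¹ *ᵥ γ)))) 0 :=
    (((hasDerivAt_id (0 : ℝ)).mul_const _).const_add _).add
      (((hasDerivAt_id (0 : ℝ)).fun_pow 2).mul_const _)
  simpa [mechVelocity] using h2

theorem multiplierMatrix_det_ne_zero (hM : M.PosDef) {G : Matrix (Fin k) (Fin n) ℝ}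
    (hG : LinearIndependent ℝ G.row) : (G * M⁻¹ * Gᵀ).det ≠ 0 := by
  have h1 := hM.inv.mul_mul_conjTranspose_same (B := G)
    (Matrix.vecMul_injective_iff.2 hG)
  rw [Matrix.conjTranspose_eq_transpose_of_trivial] at h1
  exact h1.det_pos.ne'

/-- The equation for the multipliers is the affine system `G M⁻¹ p + (G M⁻¹ Gᵀ) l = 0`, whose
nonsingular matrix is also the derivative required by the implicit function theorem. -/
theorem indexOne_mechHamiltonian (hM : M.IsSymm) (hV : ContDiff ℝ ∞ V)
    (hg : ∀ i, ContDiff ℝ ∞ (g i))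
    (hdet : ∀ q, (Matrix.of (fun i => g i q) * M⁻¹ * (Matrix.of (fun i => g i q))ᵀ).det ≠ 0) :
    IndexOne (mechHamiltonian M V g) := by
  have hmult : ∀ (x : ReducedPhase n) (l : Fin k → ℝ),
      mult (grad (mechHamiltonian M V g) (phaseMk x l))
        = Matrix.of (fun i => g i x.1) *ᵥ (M⁻¹ *ᵥ x.2)
          + (Matrix.of (fun i => g i x.1) * M⁻¹ * (Matrix.of (fun i => g i x.1))ᵀ) *ᵥ l := by
    intro x l
    have h1 : mult (grad (mechHamiltonian M V g) (phaseMk x l))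
        = Matrix.of (fun i => g i x.1) *ᵥ mechVelocity M g (phaseMk x l) := by
      ext i
      rw [mult_grad_mechHamiltonian hM hV hg]
      rfl
    rw [h1, mechVelocity, shiftedMomentum_phaseMk, Matrix.mulVec_add, Matrix.mulVec_add,
      Matrix.mulVec_mulVec, Matrix.mulVec_mulVec, Matrix.mulVec_mulVec, Matrix.mul_assoc]
  have hmem : ∀ (x : ReducedPhase n) (l : Fin k → ℝ),
      phaseMk x l ∈ constraintSet (mechHamiltonian M V g) ↔
        mult (grad (mechHamiltonian M V g) (phaseMk x l)) = 0 := fun _ _ => Iff.rfl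
  refine indexOne_of_existsUnique (contDiff_mechHamiltonian M hV hg) (fun x => ?_) ?_
  · set N := Matrix.of (fun i => g i x.1) * M⁻¹ * (Matrix.of (fun i => g i x.1))ᵀ with hN
    have hu : IsUnit N.det := isUnit_iff_ne_zero.2 (hdet x.1)
    set c := Matrix.of (fun i => g i x.1) *ᵥ (M⁻¹ *ᵥ x.2) with hc
    refine ⟨-(N⁻¹ *ᵥ c), ?_, fun l hl => ?_⟩
    · simp only [hmem, hmult]
      rw [← hN, ← hc, Matrix.mulVec_neg, Matrix.mulVec_mulVec, Matrix.mul_nonsing_inv _ hu,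
        Matrix.one_mulVec, add_neg_cancel]
    · simp only [hmem, hmult] at hl
      rw [← hN, ← hc, add_comm] at hl
      rw [← Matrix.mulVec_neg, ← eq_neg_of_add_eq_zero_left hl, Matrix.mulVec_mulVec,
        Matrix.nonsing_inv_mul _ hu, Matrix.one_mulVec]
  · intro x l _ v hv
    simp only [hmult] at hv
    set N := Matrix.of (fun i => g i x.1) * M⁻¹ * (Matrix.of (fun i => g i x.1))ᵀ with hN
    have h1 : HasFDerivAt (fun l : Fin k → ℝ => N *ᵥ l)
        (LinearMap.toContinuousLinearMap N.mulVecLin) l :=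
      (LinearMap.toContinuousLinearMap N.mulVecLin).hasFDerivAt
    rw [(h1.const_add _).fderiv] at hv
    exact Matrix.eq_zero_of_mulVec_eq_zero (hdet x.1) hv

end Mechanical

/-! ### Pencils of symmetric matrices -/

section Convexity

variable {n : ℕ}

open scoped MatrixOrder Matrix.Norms.L2Operator in
-- Writing `A = Cᴴ C` turns the pencil into `1 - t B'` with `B'` congruent to `B`. A nonzero
-- eigenvalue `μ` of `B'` would make it singular at `t = μ⁻¹`, so the Hermitian matrix `B'` has only
-- zero eigenvalues.
theorem Matrix.PosDef.eq_zero_of_pencil_injective {A B : Matrix (Fin n) (Fin n) ℝ} (hA : A.PosDef)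
    (hB : B.IsHermitian) (h : ∀ (t : ℝ) (u : Fin n → ℝ), (A - t • B) *ᵥ u = 0 → u = 0) : B = 0 := by
  obtain ⟨C, hC⟩ : ∃ C : Matrix (Fin n) (Fin n) ℝ, A = Cᴴ * C :=
    CStarAlgebra.nonneg_iff_eq_star_mul_self.1 hA.posSemidef.nonneg
  have hCu : IsUnit C.det := by
    have h1 := hA.det_pos.ne'
    rw [hC, Matrix.det_mul] at h1
    exact isUnit_iff_ne_zero.2 (right_ne_zero_of_mul h1)
  have hC1 : C⁻¹ * C = 1 := Matrix.nonsing_inv_mul _ hCu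
  have hC2 : C * C⁻¹ = 1 := Matrix.mul_nonsing_inv _ hCu
  have hC3 : Cᴴ * (C⁻¹)ᴴ = 1 := by
    rw [← Matrix.conjTranspose_mul, hC1, Matrix.conjTranspose_one]
  set B' := (C⁻¹)ᴴ * B * C⁻¹ with hB'
  have hBB' : Cᴴ * B' * C = B := by
    calc Cᴴ * B' * C = (Cᴴ * (C⁻¹)ᴴ) * B * (C⁻¹ * C) := by simp only [hB', Matrix.mul_assoc]
      _ = B := by rw [hC1, hC3, Matrix.one_mul, Matrix.mul_one]
  have hB'h : B'.IsHermitian := Matrix.isHermitian_conjTranspose_mul_mul _ hB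
  have hzero : B' = 0 := by
    rw [← hB'h.eigenvalues_eq_zero_iff]
    ext i
    by_contra hμ
    set μ := hB'h.eigenvalues i with hμdef
    have hμ0 : μ ≠ 0 := hμ
    set v : Fin n → ℝ := ⇑(hB'h.eigenvectorBasis i) with hv
    have hvB : B' *ᵥ v = μ • v := hB'h.mulVec_eigenvectorBasis i
    have hv0 : v ≠ 0 := by
      intro h0
      refine hB'h.eigenvectorBasis.toBasis.ne_zero i ?_
      ext j
      simpa using congrFun h0 j
    refine hv0 ?_
    have h1 : C⁻¹ *ᵥ v = 0 := by
      refine h μ⁻¹ _ ?_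
      rw [Matrix.sub_mulVec, Matrix.smul_mulVec, hC, ← hBB', Matrix.mulVec_mulVec,
        Matrix.mulVec_mulVec, Matrix.mul_assoc, hC2, Matrix.mul_one, Matrix.mul_assoc, hC2,
        Matrix.mul_one, ← Matrix.mulVec_mulVec, hvB, Matrix.mulVec_smul, smul_smul,
        inv_mul_cancel₀ hμ0, one_smul, sub_self]
    rw [← Matrix.one_mulVec v, ← hC2, ← Matrix.mulVec_mulVec, h1, Matrix.mulVec_zero]
  rw [← hBB', hzero, Matrix.mul_zero, Matrix.zero_mul]

end Convexity

/-! ### Hessians and convexity along segments -/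

section Hessian

variable {n : ℕ} {f : (Fin n → ℝ) → ℝ}

/-- The matrix of second partial derivatives. -/
noncomputable def hessian (f : (Fin n → ℝ) → ℝ) (v : Fin n → ℝ) : Matrix (Fin n) (Fin n) ℝ :=
  Matrix.of fun i j => grad (fun v' => grad f v' j) v i

theorem hessian_apply (hf : ContDiff ℝ ∞ f) (v : Fin n → ℝ) (i j : Fin n) :
    hessian f v i j = fderiv ℝ (fderiv ℝ f) v (Pi.single i 1) (Pi.single j 1) := by
  have h1 : DifferentiableAt ℝ (fderiv ℝ f) v :=
    ((hf.fderiv_right (m := ∞) (by simp)).differentiable (by simp)).differentiableAt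
  simp only [hessian, Matrix.of_apply, grad]
  rw [fderiv_clm_apply h1 (differentiableAt_const _)]
  simp

theorem hessian_isSymm (hf : ContDiff ℝ ∞ f) (v : Fin n → ℝ) : (hessian f v).IsSymm := by
  have hsymm : IsSymmSndFDerivAt ℝ f v := hf.contDiffAt.isSymmSndFDerivAt
    (by simpa using WithTop.coe_le_coe.2 (le_top : (2 : ℕ∞) ≤ ⊤))
  ext i j
  rw [Matrix.transpose_apply, hessian_apply hf, hessian_apply hf]
  exact hsymm _ _

theorem hasFDerivAt_grad (hf : ContDiff ℝ ∞ f) (v : Fin n → ℝ) :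
    HasFDerivAt (grad f) (LinearMap.toContinuousLinearMap (hessian f v).mulVecLin) v := by
  rw [hasFDerivAt_pi']
  intro j
  have h1 : ContDiff ℝ ∞ (fun v' => grad f v' j) := contDiff_pi.1 (contDiff_grad hf) j
  have h2 := (h1.differentiable (by simp)).differentiableAt.hasFDerivAt (x := v)
  refine h2.congr_fderiv (ContinuousLinearMap.ext fun u => ?_)
  rw [fderiv_eq_grad_dotProduct]
  have h3 := hessian_isSymm hf v
  change _ = (hessian f v *ᵥ u) j
  rw [← h3.eq]
  rfl

theorem hasDerivAt_line (hf : ContDiff ℝ ∞ f) (v d : Fin n → ℝ) (t : ℝ) :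
    HasDerivAt (fun t : ℝ => f (v + t • d)) (grad f (v + t • d) ⬝ᵥ d) t := by
  have h1 : HasDerivAt (fun t : ℝ => v + t • d) d t := by
    simpa using ((hasDerivAt_id t).smul_const d).const_add v
  rw [← fderiv_eq_grad_dotProduct]
  exact (hf.differentiable (by simp)).differentiableAt.hasFDerivAt.comp_hasDerivAt t h1

theorem hasDerivAt_grad_line (hf : ContDiff ℝ ∞ f) (v d : Fin n → ℝ) (t : ℝ) :
    HasDerivAt (fun t : ℝ => grad f (v + t • d) ⬝ᵥ d)
      (d ⬝ᵥ (hessian f (v + t • d) *ᵥ d)) t := by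
  have h1 : HasDerivAt (fun t : ℝ => v + t • d) d t := by
    simpa using ((hasDerivAt_id t).smul_const d).const_add v
  have h2 := hasDerivAt_pi.1 ((hasFDerivAt_grad hf (v + t • d)).comp_hasDerivAt t h1)
  rw [dotProduct_comm]
  exact HasDerivAt.fun_sum fun i _ => (h2 i).mul_const (d i)

/-- By the mean value theorem along the segment, the pairing is the Hessian form at an intermediate
point. -/
theorem grad_strictMono (hf : ContDiff ℝ ∞ f) (hpos : ∀ v, (hessian f v).PosDef)
    {u v : Fin n → ℝ} (huv : u ≠ v) : 0 < (grad f u - grad f v) ⬝ᵥ (u - v) := by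
  have hd := fun t => hasDerivAt_grad_line hf v (u - v) t
  obtain ⟨c, -, hc⟩ := exists_hasDerivAt_eq_slope
    (fun t : ℝ => grad f (v + t • (u - v)) ⬝ᵥ (u - v)) _ zero_lt_one
    (fun t _ => (hd t).continuousAt.continuousWithinAt) (fun t _ => hd t)
  have h1 := (hpos (v + c • (u - v))).dotProduct_mulVec_pos (sub_ne_zero.2 huv)
  rw [star_trivial, hc] at h1
  simpa only [one_smul, zero_smul, add_zero, sub_zero, div_one, add_sub_cancel,
    ← sub_dotProduct] using h1

theorem grad_inequality (hf : ContDiff ℝ ∞ f) (hpos : ∀ v, (hessian f v).PosDef)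
    (u v : Fin n → ℝ) : f v + grad f v ⬝ᵥ (u - v) ≤ f u := by
  have hd := fun t => hasDerivAt_line hf v (u - v) t
  obtain ⟨c, hc0, hc⟩ := exists_hasDerivAt_eq_slope
    (fun t : ℝ => f (v + t • (u - v))) _ zero_lt_one
    (fun t _ => (hd t).continuousAt.continuousWithinAt) (fun t _ => hd t)
  simp only [one_smul, zero_smul, add_zero, sub_zero, div_one, add_sub_cancel] at hc
  rcases eq_or_ne u v with rfl | huv
  · simp
  have h1 := grad_strictMono hf hpos (u := v + c • (u - v)) (v := v) (by
    simp [sub_eq_zero, huv, hc0.1.ne'])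
  rw [add_sub_cancel_left, dotProduct_smul, smul_eq_mul, sub_dotProduct, hc] at h1
  have h2 := pos_of_mul_pos_right h1 hc0.1.le
  linarith

theorem eq_affine_of_hessian_eq_zero (hf : ContDiff ℝ ∞ f) (h0 : ∀ v, hessian f v = 0)
    (v : Fin n → ℝ) : grad f v = grad f 0 ∧ f v = f 0 + grad f 0 ⬝ᵥ v := by
  have hgrad : ∀ v, grad f v = grad f 0 := fun v =>
    is_const_of_fderiv_eq_zero (𝕜 := ℝ) ((contDiff_grad hf).differentiable (by simp)) (fun v => by
      rw [(hasFDerivAt_grad hf v).fderiv, h0]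
      ext u
      simp) v 0
  refine ⟨hgrad v, ?_⟩
  have hd := fun t => hasDerivAt_line hf 0 v t
  obtain ⟨c, hc0, hc⟩ := exists_hasDerivAt_eq_slope
    (fun t : ℝ => f (0 + t • v)) _ zero_lt_one
    (fun t _ => (hd t).continuousAt.continuousWithinAt) (fun t _ => hd t)
  simp only [hgrad, one_smul, zero_smul, add_zero, sub_zero, div_one, zero_add] at hc
  linarith

end Hessian

/-! ### Duality for a convex function with affine constraints -/

section ConstrainedConvex

variable {n k : ℕ} {f : (Fin n → ℝ) → ℝ} {Γ : Matrix (Fin k) (Fin n) ℝ} {c : Fin k → ℝ}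
  {p : Fin n → ℝ} {w : (Fin k → ℝ) → (Fin n → ℝ)}

theorem Matrix.eq_zero_of_transpose_mulVec_eq_zero (hΓ : Function.Surjective Γ.mulVec)
    {l : Fin k → ℝ} (h : Γᵀ *ᵥ l = 0) : l = 0 := by
  obtain ⟨v, hv⟩ := hΓ l
  rw [← dotProduct_self_eq_zero]
  nth_rw 2 [← hv]
  rw [Matrix.dotProduct_mulVec, ← Matrix.mulVec_transpose, h, zero_dotProduct]

theorem dotProduct_mulVec_eq_transpose (l : Fin k → ℝ) (v : Fin n → ℝ) :
    l ⬝ᵥ (Γ *ᵥ v) = (Γᵀ *ᵥ l) ⬝ᵥ v := by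
  rw [Matrix.dotProduct_mulVec, Matrix.mulVec_transpose]

/-- For two solutions, `w l - w m` lies in the kernel of `Γ` while the gradients differ by an
element of the range of `Γᵀ`. These are orthogonal, so strict monotonicity gives `w l = w m`, and
`Γᵀ` is injective. -/
theorem multiplier_unique (hf : ContDiff ℝ ∞ f) (hpos : ∀ v, (hessian f v).PosDef)
    (hΓ : Function.Surjective Γ.mulVec) (hw : ∀ l, grad f (w l) = p + Γᵀ *ᵥ l)
    {l m : Fin k → ℝ} (hl : c + Γ *ᵥ w l = 0) (hm : c + Γ *ᵥ w m = 0) : l = m := by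
  have hΓlm : Γ *ᵥ (w l - w m) = 0 := by
    rw [Matrix.mulVec_sub, eq_neg_of_add_eq_zero_right hl, eq_neg_of_add_eq_zero_right hm,
      sub_self]
  have hgl : grad f (w l) - grad f (w m) = Γᵀ *ᵥ (l - m) := by
    rw [hw, hw, Matrix.mulVec_sub]
    abel
  have hwlm : w l = w m := by
    by_contra hne
    have h1 := grad_strictMono hf hpos hne
    rw [hgl, ← dotProduct_mulVec_eq_transpose, hΓlm, dotProduct_zero] at h1
    exact lt_irrefl _ h1
  rw [hwlm, sub_self] at hgl
  exact sub_eq_zero.1 (Matrix.eq_zero_of_transpose_mulVec_eq_zero hΓ hgl.symm)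

/-- The infinitesimal form of uniqueness: `η = dw(v)` satisfies `Γ η = 0` and `hess f · η = Γᵀ v`,
so the Hessian form vanishes at `η`; then `η = 0`, and `v = 0` because `Γᵀ` is injective. -/
theorem multiplier_derivative_injective (hf : ContDiff ℝ ∞ f) (hpos : ∀ v, (hessian f v).PosDef)
    (hΓ : Function.Surjective Γ.mulVec) (hws : ContDiff ℝ ∞ w)
    (hw : ∀ l, grad f (w l) = p + Γᵀ *ᵥ l) (l v : Fin k → ℝ)
    (hv : fderiv ℝ (fun l => c + Γ *ᵥ w l) l v = 0) : v = 0 := by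
  have hwd := (hws.differentiable (by simp)).differentiableAt.hasFDerivAt (x := l)
  set η := fderiv ℝ w l v with hη
  have h1 : HasFDerivAt (fun l => c + Γ *ᵥ w l)
      ((LinearMap.toContinuousLinearMap Γ.mulVecLin).comp (fderiv ℝ w l)) l :=
    ((LinearMap.toContinuousLinearMap Γ.mulVecLin).hasFDerivAt.comp l hwd).const_add c
  have hΓη : Γ *ᵥ η = 0 := by
    rw [h1.fderiv] at hv
    exact hv
  have h2 := (hasFDerivAt_grad hf (w l)).comp l hwd
  have h3 : HasFDerivAt (fun l => p + Γᵀ *ᵥ l)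
      (LinearMap.toContinuousLinearMap Γᵀ.mulVecLin) l :=
    (LinearMap.toContinuousLinearMap Γᵀ.mulVecLin).hasFDerivAt.const_add p
  have h4 : hessian f (w l) *ᵥ η = Γᵀ *ᵥ v := by
    have h5 : HasFDerivAt (fun l => p + Γᵀ *ᵥ l) _ l :=
      h2.congr_of_eventuallyEq (Eventually.of_forall fun l => (hw l).symm)
    exact congrArg (fun T : (Fin k → ℝ) →L[ℝ] (Fin n → ℝ) => T v) (h5.unique h3)
  have hη0 : η = 0 := by
    by_contra hne
    have h5 := (hpos (w l)).dotProduct_mulVec_pos hne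
    rw [star_trivial, h4, dotProduct_comm, ← dotProduct_mulVec_eq_transpose, hΓη,
      dotProduct_zero] at h5
    exact lt_irrefl _ h5
  rw [hη0, Matrix.mulVec_zero] at h4
  exact Matrix.eq_zero_of_transpose_mulVec_eq_zero hΓ h4.symm

/-- The dual function of a convex problem with affine constraints has a critical point. -/
theorem multiplier_exists (hf : ContDiff ℝ ∞ f) (hpos : ∀ v, (hessian f v).PosDef)
    (hΓ : Function.Surjective Γ.mulVec) (hw : ∀ l, grad f (w l) = p + Γᵀ *ᵥ l)
    {D : (Fin k → ℝ) → ℝ} (hDc : Continuous D)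
    (hD : ∀ l, D l = w l ⬝ᵥ p - f (w l) + l ⬝ᵥ (c + Γ *ᵥ w l))
    (hD' : ∀ l i, HasDerivAt (fun t : ℝ => D (l + t • Pi.single i 1)) ((c + Γ *ᵥ w l) i) 0) :
    ∃ l, c + Γ *ᵥ w l = 0 := by
  -- Weak duality: by convexity `D l` is the supremum over `v` of the left side, attained at `w l`.
  have hlow : ∀ l v, v ⬝ᵥ p - f v + l ⬝ᵥ (c + Γ *ᵥ v) ≤ D l := by
    intro l v
    have h1 := grad_inequality hf hpos v (w l)
    rw [hw, dotProduct_sub, add_dotProduct, add_dotProduct] at h1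
    rw [hD, dotProduct_add, dotProduct_add, dotProduct_mulVec_eq_transpose,
      dotProduct_mulVec_eq_transpose, dotProduct_comm v, dotProduct_comm (w l)]
    linarith
  obtain ⟨ρ, hρ⟩ := Γ.mulVecLin.exists_rightInverse_of_surjective (LinearMap.range_eq_top.2 hΓ)
  have hρ' : ∀ y, Γ *ᵥ ρ y = y := fun y => LinearMap.congr_fun hρ y
  have hρc : Continuous ρ := LinearMap.continuous_of_finiteDimensional ρ
  have hcont : Continuous fun y => ρ (y - c) ⬝ᵥ p - f (ρ (y - c)) := by
    have h1 : Continuous fun y => ρ (y - c) := hρc.comp (continuous_id.sub continuous_const)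
    exact (h1.dotProduct continuous_const).sub (hf.continuous.comp h1)
  obtain ⟨C, hC⟩ := (isCompact_closedBall (0 : Fin k → ℝ) 1).exists_bound_of_continuousOn
    hcont.continuousOn
  have hcoer : ∀ l, ‖l‖ + -C ≤ D l := by
    intro l
    -- Testing with a velocity for which `c + Γ v` is the sign vector of `l` produces the `ℓ¹` norm
    -- of `l`; the remaining terms are bounded, since sign vectors lie in the unit ball.
    set y : Fin k → ℝ := fun i => SignType.sign (l i) with hy
    have hy1 : y ∈ closedBall (0 : Fin k → ℝ) 1 := by
      rw [mem_closedBall_zero_iff, pi_norm_le_iff_of_nonneg zero_le_one]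
      intro i
      rcases lt_trichotomy (l i) 0 with h | h | h <;> simp [hy, h]
    have h1 := hlow l (ρ (y - c))
    rw [hρ', add_sub_cancel] at h1
    have h2 : l ⬝ᵥ y = ∑ i, |l i| := by
      simp only [dotProduct, hy, self_mul_sign]
    have h3 : ‖l‖ ≤ ∑ i, |l i| := by
      rw [pi_norm_le_iff_of_nonneg (by positivity)]
      intro i
      exact Finset.single_le_sum (f := fun i => |l i|) (fun i _ => abs_nonneg _)
        (Finset.mem_univ i)
    have h4 := (abs_le.1 (hC y hy1)).1
    linarith
  obtain ⟨l, hl⟩ := hDc.exists_forall_le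
    (tendsto_atTop_mono hcoer (tendsto_atTop_add_const_right _ _ tendsto_norm_cocompact_atTop))
  refine ⟨l, funext fun i => ?_⟩
  refine IsLocalMin.hasDerivAt_eq_zero (Eventually.of_forall fun t => ?_) (hD' l i)
  simpa using hl (l + t • Pi.single i 1)

end ConstrainedConvex

/-! ### General Lagrangians with velocity-dependent constraints -/

section Lagrangian

variable {n k : ℕ} {L : (Fin n → ℝ) → (Fin n → ℝ) → ℝ}
  {g : Fin k → (Fin n → ℝ) → (Fin n → ℝ) → ℝ} {w : Phase n k → (Fin n → ℝ)}

theorem contDiff_right {L : (Fin n → ℝ) → (Fin n → ℝ) → ℝ}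
    (hL : ContDiff ℝ ∞ (fun x : (Fin n → ℝ) × (Fin n → ℝ) => L x.1 x.2)) (q : Fin n → ℝ) :
    ContDiff ℝ ∞ (L q) :=
  hL.comp (contDiff_const.prodMk contDiff_id)

theorem contDiff_genHamiltonian
    (hL : ContDiff ℝ ∞ (fun x : (Fin n → ℝ) × (Fin n → ℝ) => L x.1 x.2))
    (hg : ∀ i, ContDiff ℝ ∞ (fun x : (Fin n → ℝ) × (Fin n → ℝ) => g i x.1 x.2))
    (hw : ContDiff ℝ ∞ w) : ContDiff ℝ ∞ (genHamiltonian L g w) :=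
  (hw.dotProduct contDiff_momn).sub ((hL.comp (contDiff_posn.prodMk hw)).sub
    (ContDiff.sum fun i _ => (contDiff_pi.1 contDiff_mult i).mul
      ((hg i).comp (contDiff_posn.prodMk hw))))

theorem legendre_eq (hL : ContDiff ℝ ∞ (fun x : (Fin n → ℝ) × (Fin n → ℝ) => L x.1 x.2))
    (hg : ∀ i, ContDiff ℝ ∞ (fun x : (Fin n → ℝ) × (Fin n → ℝ) => g i x.1 x.2))
    (q v : Fin n → ℝ) (l : Fin k → ℝ) :
    legendre L g q v l = grad (L q) v - ∑ i, l i • grad (g i q) v := by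
  have h1 : HasFDerivAt (fun v' => extLagrangian L g q v' l)
      (fderiv ℝ (L q) v - ∑ i, l i • fderiv ℝ (g i q) v) v :=
    ((contDiff_right hL q).differentiable (by simp)).differentiableAt.hasFDerivAt.sub
      (HasFDerivAt.fun_sum fun i _ =>
        (((contDiff_right (hg i) q).differentiable (by simp)).differentiableAt.hasFDerivAt).const_mul
          (l i))
  ext j
  simp only [legendre, grad, h1.fderiv]
  simp [sum_apply, grad]

/-- Envelope argument: the Legendre relation `∇_v F = p` cancels the contribution of the varying
velocity, leaving only the explicit dependence on the multiplier. -/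
theorem mult_grad_genHamiltonian
    (hL : ContDiff ℝ ∞ (fun x : (Fin n → ℝ) × (Fin n → ℝ) => L x.1 x.2))
    (hg : ∀ i, ContDiff ℝ ∞ (fun x : (Fin n → ℝ) × (Fin n → ℝ) => g i x.1 x.2))
    (hw : IsLegendreInverse L g w) (z : Phase n k) (i : Fin k) :
    mult (grad (genHamiltonian L g w) z) i = g i (posn z) (w z) := by
  have h1 := hasDerivAt_multiplier_line (contDiff_genHamiltonian hL hg hw.smooth) (phaseProj z)
    (mult z) i
  rw [phaseMk_phaseProj] at h1
  refine h1.unique ?_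
  set W : ℝ → (Fin n → ℝ) := fun t => w (phaseMk (phaseProj z) (mult z + t • Pi.single i 1))
    with hW
  have hW0 : W 0 = w z := by simp [hW]
  have hWs : ContDiff ℝ ∞ W := hw.smooth.comp (contDiff_phaseMk.comp
    (contDiff_const.prodMk (contDiff_const.add (contDiff_id.smul contDiff_const))))
  have hWd : HasDerivAt W (deriv W 0) 0 :=
    (hWs.differentiable (by simp)).differentiableAt.hasDerivAt
  have hF : ContDiff ℝ ∞ (fun v => extLagrangian L g (posn z) v (mult z)) :=
    (contDiff_right hL _).sub (ContDiff.sum fun i _ => contDiff_const.mul (contDiff_right (hg i) _))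
  have hH : ∀ t : ℝ, genHamiltonian L g w (phaseMk (phaseProj z) (mult z + t • Pi.single i 1))
      = W t ⬝ᵥ momn z - extLagrangian L g (posn z) (W t) (mult z) + t * g i (posn z) (W t) := by
    intro t
    simp only [genHamiltonian, extLagrangian, posn_phaseMk, momn_phaseMk, mult_phaseMk,
      Pi.add_apply, Pi.smul_apply, smul_eq_mul, add_mul, Finset.sum_add_distrib]
    have h2 : ∑ j, t * (Pi.single i (1 : ℝ) : Fin k → ℝ) j * g j (posn z) (W t)
        = t * g i (posn z) (W t) := by
      simp [Pi.single_apply]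
    change W t ⬝ᵥ momn z - (L (posn z) (W t) - (∑ j, mult z j * g j (posn z) (W t)
      + ∑ j, t * (Pi.single i (1 : ℝ) : Fin k → ℝ) j * g j (posn z) (W t))) = _
    rw [h2]
    ring
  simp only [hH]
  have hd1 : HasDerivAt (fun t => W t ⬝ᵥ momn z) (deriv W 0 ⬝ᵥ momn z) 0 :=
    HasDerivAt.fun_sum fun j _ => (hasDerivAt_pi.1 hWd j).mul_const _
  have hd2 : HasDerivAt (fun t => extLagrangian L g (posn z) (W t) (mult z))
      (momn z ⬝ᵥ deriv W 0) 0 := by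
    have h3 := ((hF.differentiable (by simp)).differentiableAt (x := W 0)).hasFDerivAt
    have h4 := h3.comp_hasDerivAt (0 : ℝ) hWd
    rw [fderiv_eq_grad_dotProduct] at h4
    have h5 : grad (fun v => extLagrangian L g (posn z) v (mult z)) (W 0) = momn z := by
      rw [hW0]
      exact hw.right_inv z
    rwa [h5] at h4
  have hd3 : HasDerivAt (fun t => t * g i (posn z) (W t))
      (1 * g i (posn z) (W 0) + 0 * fderiv ℝ (g i (posn z)) (W 0) (deriv W 0)) 0 :=
    (hasDerivAt_id (0 : ℝ)).mul
      ((((contDiff_right (hg i) (posn z)).differentiable (by simp)).differentiableAt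
        (x := W 0)).hasFDerivAt.comp_hasDerivAt (0 : ℝ) hWd)
  have hd := (hd1.sub hd2).add hd3
  rw [dotProduct_comm, sub_self, zero_add, zero_mul, add_zero, one_mul, hW0] at hd
  exact hd

/-- If the Legendre transform is invertible for all multipliers and the Lagrangian is convex, the
constraints are affine in the velocity. -/
theorem IsLegendreInverse.hessian_constraint_eq_zero
    (hL : ContDiff ℝ ∞ (fun x : (Fin n → ℝ) × (Fin n → ℝ) => L x.1 x.2))
    (hg : ∀ i, ContDiff ℝ ∞ (fun x : (Fin n → ℝ) × (Fin n → ℝ) => g i x.1 x.2))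
    (hw : IsLegendreInverse L g w) (hpos : ∀ q v, (hessian (L q) v).PosDef) (i : Fin k)
    (q v : Fin n → ℝ) : hessian (g i q) v = 0 := by
  have hLq := contDiff_right hL q
  have hgq := contDiff_right (hg i) q
  refine (hpos q v).eq_zero_of_pencil_injective (by
    rw [Matrix.IsHermitian, Matrix.conjTranspose_eq_transpose_of_trivial]
    exact hessian_isSymm hgq v) fun t u hu => ?_
  -- This multiplier turns the velocity Hessian of the extended Lagrangian into the pencil `hess L -
  -- t hess g i`.
  set l : Fin k → ℝ := t • Pi.single i 1 with hl
  have hleg : ∀ v, legendre L g q v l = grad (L q) v - t • grad (g i q) v := by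
    intro v
    rw [legendre_eq hL hg, Finset.sum_eq_single i]
    · simp [hl]
    · intro j _ hj
      simp [hl, hj]
    · simp
  have hlegd : HasFDerivAt (fun v => legendre L g q v l)
      (LinearMap.toContinuousLinearMap (hessian (L q) v).mulVecLin
        - t • LinearMap.toContinuousLinearMap (hessian (g i q) v).mulVecLin) v := by
    simp only [hleg]
    exact (hasFDerivAt_grad hLq v).sub ((hasFDerivAt_grad hgq v).const_smul t)
  have hwp : ContDiff ℝ ∞ (fun P : Fin n → ℝ => w (phaseMk (q, P) l)) :=
    hw.smooth.comp (contDiff_phaseMk.comp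
      ((contDiff_const.prodMk contDiff_id).prodMk contDiff_const))
  have h1 := ((hwp.differentiable (by simp)).differentiableAt
    (x := legendre L g q v l)).hasFDerivAt.comp v hlegd
  -- Differentiating the identity "`w` after the Legendre transform" gives a left inverse of the
  -- pencil, which is therefore injective.
  have h2 : HasFDerivAt (fun v : Fin n → ℝ => v) _ v :=
    h1.congr_of_eventuallyEq (Eventually.of_forall fun v =>
      (hw.left_inv (phaseMk (q, legendre L g q v l) l) v rfl).symm)
  have h3 := congrArg (fun T : (Fin n → ℝ) →L[ℝ] (Fin n → ℝ) => T u)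
    (h2.unique (hasFDerivAt_id v))
  have h4 : (LinearMap.toContinuousLinearMap (hessian (L q) v).mulVecLin
        - t • LinearMap.toContinuousLinearMap (hessian (g i q) v).mulVecLin) u = 0 := by
    rw [← hu, Matrix.sub_mulVec, Matrix.smul_mulVec]
    rfl
  rw [ContinuousLinearMap.comp_apply, h4, map_zero] at h3
  exact h3.symm

/-- With constraints affine in the velocity, their Jacobian `Γ` depends on `q` alone and the
Legendre relation reads `∇L(w) = p + Γᵀ l`. Hence `H` is, for fixed `(q, p)`, the dual function of a
convex problem whose critical points solve `∂H/∂l = 0`. -/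
theorem indexOne_genHamiltonian
    (hL : ContDiff ℝ ∞ (fun x : (Fin n → ℝ) × (Fin n → ℝ) => L x.1 x.2))
    (hg : ∀ i, ContDiff ℝ ∞ (fun x : (Fin n → ℝ) × (Fin n → ℝ) => g i x.1 x.2))
    (hw : IsLegendreInverse L g w) (hrank : ∀ q v, (velJacobian g q v).rank = k)
    (hpos : ∀ q v, (velHessian L q v).PosDef) : IndexOne (genHamiltonian L g w) := by
  replace hpos : ∀ q v, (hessian (L q) v).PosDef := hpos
  have hH := contDiff_genHamiltonian hL hg hw.smooth
  have haff := fun i q v => eq_affine_of_hessian_eq_zero (contDiff_right (hg i) q)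
    (hw.hessian_constraint_eq_zero hL hg hpos i q) v
  have hsurj : ∀ q, Function.Surjective (velJacobian g q 0).mulVec := by
    intro q
    have h1 : LinearMap.range (velJacobian g q 0).mulVecLin = ⊤ := by
      refine Submodule.eq_top_of_finrank_eq ?_
      rw [Module.finrank_fin_fun]
      exact hrank q 0
    exact LinearMap.range_eq_top.1 h1
  have hgΓ : ∀ q v, (fun i => g i q v) = (fun i => g i q 0) + velJacobian g q 0 *ᵥ v := by
    intro q v
    ext i
    exact (haff i q v).2
  have hmult : ∀ (x : ReducedPhase n) (l : Fin k → ℝ),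
      mult (grad (genHamiltonian L g w) (phaseMk x l))
        = (fun i => g i x.1 0) + velJacobian g x.1 0 *ᵥ w (phaseMk x l) := by
    intro x l
    rw [← hgΓ]
    ext i
    exact mult_grad_genHamiltonian hL hg hw _ i
  have hgrad : ∀ (x : ReducedPhase n) (l : Fin k → ℝ),
      grad (L x.1) (w (phaseMk x l)) = x.2 + (velJacobian g x.1 0)ᵀ *ᵥ l := by
    intro x l
    have h1 := hw.right_inv (phaseMk x l)
    rw [legendre_eq hL hg, sub_eq_iff_eq_add] at h1
    simp only [posn_phaseMk, momn_phaseMk, mult_phaseMk] at h1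
    rw [h1]
    congr 1
    ext j
    simp only [(haff _ x.1 _).1]
    simp [velJacobian, Matrix.mulVec, dotProduct, mul_comm]
  have hwl : ∀ x : ReducedPhase n, ContDiff ℝ ∞ (fun l => w (phaseMk x l)) := fun x =>
    hw.smooth.comp (contDiff_phaseMk.comp (contDiff_const.prodMk contDiff_id))
  have hmem : ∀ (x : ReducedPhase n) (l : Fin k → ℝ),
      phaseMk x l ∈ constraintSet (genHamiltonian L g w) ↔
        (fun i => g i x.1 0) + velJacobian g x.1 0 *ᵥ w (phaseMk x l) = 0 := fun x l => by
    rw [← hmult]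
    rfl
  refine indexOne_of_existsUnique hH (fun x => ?_) fun x l _ v hv => ?_
  · simp only [hmem]
    refine existsUnique_of_exists_of_unique ?_ fun l m hl hm =>
      multiplier_unique (w := fun l => w (phaseMk x l)) (contDiff_right hL x.1) (hpos x.1)
        (hsurj x.1) (hgrad x) hl hm
    refine multiplier_exists (w := fun l => w (phaseMk x l))
      (D := fun l => genHamiltonian L g w (phaseMk x l)) (contDiff_right hL x.1) (hpos x.1)
      (hsurj x.1) (hgrad x) ?_ (fun l => ?_) fun l i => ?_
    · exact (hH.comp (contDiff_phaseMk.comp (contDiff_const.prodMk contDiff_id))).continuous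
    · rw [← hgΓ]
      simp only [genHamiltonian, extLagrangian, posn_phaseMk, momn_phaseMk, mult_phaseMk,
        dotProduct]
      ring
    · rw [← hmult]
      exact hasDerivAt_multiplier_line hH x l i
  · simp only [hmult] at hv
    exact multiplier_derivative_injective (w := fun l => w (phaseMk x l)) (contDiff_right hL x.1)
      (hpos x.1) (hsurj x.1) (hwl x) (hgrad x) l v hv

end Lagrangian

end

/-! ### The two formulations -/

theorem mainTheorem5 (n k s : ℕ) (a : Matrix (Fin s) (Fin s) ℝ) (b : Fin s → ℝ)
    (hab : IsSymplecticRK a b) :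
    (∀ (M : Matrix (Fin n) (Fin n) ℝ) (V : (Fin n → ℝ) → ℝ)
        (g : Fin k → (Fin n → ℝ) → (Fin n → ℝ)),
      M.IsSymm → IsUnit M.det → ContDiff ℝ ∞ V → (∀ i, ContDiff ℝ ∞ (g i)) →
      (∀ q, LinearIndependent ℝ (fun i => g i q)) →
      (M.PosDef ∨
        ∀ q, (Matrix.of (fun i => g i q) * M⁻¹ * (Matrix.of (fun i => g i q))ᵀ).det ≠ 0) →
      IndexOne (mechHamiltonian M V g) ∧
      IsWellDefinedSymplectic a b (mechHamiltonian M V g) ∧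
      (∀ r : ℕ, 1 ≤ r → RKHasOrder a b r →
        IsConvergentOfOrder a b (mechHamiltonian M V g) r) ∧
      ConstraintsExact a b (mechHamiltonian M V g) (fun i q v => g i q ⬝ᵥ v)
        (mechVelocity M g)) ∧
    (∀ (L : (Fin n → ℝ) → (Fin n → ℝ) → ℝ) (g : Fin k → (Fin n → ℝ) → (Fin n → ℝ) → ℝ)
        (w : Phase n k → (Fin n → ℝ)),
      ContDiff ℝ ∞ (fun x : (Fin n → ℝ) × (Fin n → ℝ) => L x.1 x.2) →
      (∀ i, ContDiff ℝ ∞ (fun x : (Fin n → ℝ) × (Fin n → ℝ) => g i x.1 x.2)) →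
      IsLegendreInverse L g w →
      (((∀ q v, (velJacobian g q v).rank = k) ∧ (∀ q v, (velHessian L q v).PosDef)) ∨
        IndexOne (genHamiltonian L g w)) →
      IndexOne (genHamiltonian L g w) ∧
      IsWellDefinedSymplectic a b (genHamiltonian L g w) ∧
      (∀ r : ℕ, 1 ≤ r → RKHasOrder a b r →
        IsConvergentOfOrder a b (genHamiltonian L g w) r) ∧
      ConstraintsExact a b (genHamiltonian L g w) g w) := by
  refine ⟨fun M V g hM _ hV hg hli hdet => ?_, fun L g w hL hg hw hcase => ?_⟩
  · refine (indexOne_mechHamiltonian hM hV hg fun q => ?_).rungeKutta_properties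
      (contDiff_mechHamiltonian M hV hg) hab (mult_grad_mechHamiltonian hM hV hg)
    rcases hdet with hpos | hdet
    · exact multiplierMatrix_det_ne_zero hpos (hli q)
    · exact hdet q
  · refine IndexOne.rungeKutta_properties ?_ (contDiff_genHamiltonian hL hg hw.smooth) hab
      (mult_grad_genHamiltonian hL hg hw)
    rcases hcase with ⟨hrank, hpos⟩ | hind
    · exact indexOne_genHamiltonian hL hg hw hrank hpos
    · exact hind
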